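/- **Definitions.** A *topos* is a locally small category with finite limits and colimits, exponentials and a subobject classifier. An *internal frame* in a topos is a partially ordered object that has finite meets and joins of all internal families, binary meets distributing over joins; homomorphisms preserve finite meets and internal joins. A geometric morphism $f:\mathscr E\to\mathscr E'$ is an adjunction $f^*\dashv f_*$, $f_*:\mathscr E\to\mathscr E'$, with $f^*$ preserving finite limits. The direct image of an internal frame is an internal frame, and $f^\sharp F'$ denotes the value at $F'$ of the left adjoint of $f_*$ on internal frames. $\mathbf{FrmTop}$ is the category of pairs $(\mathscr E,F)$ of a topos and an internal frame in it; a morphism $(\mathscr E,F)\to(\mathscr E',F')$ is a geometric morphism $f:\mathscr E\to\mathscr E'$ with a homomorphism $f^\sharp F'\to F$ of internal frames (equivalently, $F'\to f_*F$), two such being identified when there is an isomorphism of the geometric morphisms compatible with the frame homomorphisms. A *box presentation* $S/I$ is a map $S\to I$ of finite sets; a morphism $S'/I'\to S/I$ in $\mathbf{Box}$ is a commutative square given by $\varphi:S'\to S$ and $\bar\varphi:I'\to I$ with $\varphi$ injective on every fibre $S'_{i'}$. A *context* of $S/I$ is a subset $c\subset S$ on which the map to $I$ is injective; $\mathscr C_{S/I}$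 is the poset of contexts under inclusion. $L_{S/I}:\mathscr C_{S/I}\to\mathbf{Bool}$ sends $c$ to the free Boolean algebra $2^{2^c}$ on $c$. The internal frame $F_{S/I}=\mathrm{Idl}\,L_{S/I}$ in $\mathbf{Set}^{\mathscr C_{S/I}}$ sends $c$ to the set, ordered by inclusion, of subfunctors $J\subset L_{S/I}|_{\uparrow c}$ such that $J(d)$ is a (non-empty) order ideal of $L_{S/I}(d)$ for every $d\ge c$. For $x\in L_{S/I}(c)$, let ${\downarrow}x\in F_{S/I}(c)$ be the subfunctor sending $d\ge c$ to the principal ideal generated by the image of $x$ in $L_{S/I}(d)$. **Proposition.** The assignment $S/I\mapsto(\mathbf{Set}^{\mathscr C_{S/I}},F_{S/I})$ is the object part of a functor $\mathbf{Box}^{\mathrm{op}}\to\mathbf{FrmTop}$. It can be chosen so that its value at a morphism $(\varphi,\bar\varphi):S'/I'\to S/I$ is represented by the following pair: (1) the geometric morphism $\phi:\mathbf{Set}^{\mathscr C_{S/I}}\to\mathbf{Set}^{\mathscr C_{S'/I'}}$ induced by the isotone map $\phi:\mathscr C_{S/I}\to\mathscr C_{S'/I'}$, $c\mapsto\varphi^{-1}(c)$,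 i.e. $\phi^*$ is precomposition with $\phi$ and $(\phi_*F)(c')=\lim_{c'\le\phi(c)}F(c)$; (2) a homomorphism of internal frames $\phi^\sharp F_{S'/I'}\to F_{S/I}$ (where $\phi^\sharp F_{S'/I'}$ exists) whose transpose $F_{S'/I'}\to\phi_*F_{S/I}$ extends the homomorphism of internal Boolean algebras $\phi^*L_{S'/I'}\to L_{S/I}$ given by the maps $\varphi^{-1}(c)\to c$: the corresponding morphism $\phi^*F_{S'/I'}\to F_{S/I}$ sends ${\downarrow}x$ to ${\downarrow}y$, where $y\in L_{S/I}(c)$ is the image of $x\in L_{S'/I'}(\varphi^{-1}(c))$. -/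

import Mathlib

open CategoryTheory Limits Opposite

universe v u v₁ u₁ v₂ u₂ v₃ u₃ v₄ u₄

/-! ## Topoi and geometric morphisms -/

/-- An elementary topos: finite limits and colimits, exponentials, a subobject classifier. -/
class IsTopos (E : Type u) [Category.{v} E] : Prop where
  hasFiniteLimits : HasFiniteLimits E
  hasFiniteColimits : HasFiniteColimits E
  hasExponentials : ∀ X : E, (prod.functor.obj X).IsLeftAdjoint
  hasSubobjectClassifier : HasSubobjectClassifier E

attribute [instance] IsTopos.hasFiniteLimits IsTopos.hasFiniteColimits

/-- A geometric morphism `E → E'`: a direct image functor `f_* : E ⥤ E'` with a finite limit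
preserving left adjoint `f^* : E' ⥤ E`. -/
structure GeometricMorphism (E : Type u₁) [Category.{v₁} E] (E' : Type u₂) [Category.{v₂} E'] where
  direct : E ⥤ E'
  inverse : E' ⥤ E
  adj : inverse ⊣ direct
  preserves : PreservesFiniteLimits inverse

namespace GeometricMorphism

attribute [instance] GeometricMorphism.preserves

variable {E : Type u₁} [Category.{v₁} E] {E' : Type u₂} [Category.{v₂} E']
  {E'' : Type u₃} [Category.{v₃} E'']

/-- The identity geometric morphism. -/
abbrev id (E : Type u₁) [Category.{v₁} E] : GeometricMorphism E E where
  direct := 𝟭 E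
  inverse := 𝟭 E
  adj := Adjunction.id
  preserves := inferInstance

/-- Composition of geometric morphisms, in diagrammatic order. -/
abbrev comp (f : GeometricMorphism E E') (g : GeometricMorphism E' E'') :
    GeometricMorphism E E'' where
  direct := f.direct ⋙ g.direct
  inverse := g.inverse ⋙ f.inverse
  adj := g.adj.comp f.adj
  preserves := comp_preservesFiniteLimits _ _

/-- The transpose `f^* T ⟶ X` of a morphism `T ⟶ f_* X`. -/
def tr (f : GeometricMorphism E E') {T : E'} {X : E} (x : T ⟶ f.direct.obj X) :
    f.inverse.obj T ⟶ X :=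
  (f.adj.homEquiv T X).symm x

/-- The transpose `T ⟶ f_* X` of a morphism `f^* T ⟶ X`. -/
def untr (f : GeometricMorphism E E') {T : E'} {X : E} (x : f.inverse.obj T ⟶ X) :
    T ⟶ f.direct.obj X :=
  f.adj.homEquiv T X x

@[simp] lemma tr_untr (f : GeometricMorphism E E') {T : E'} {X : E} (x : f.inverse.obj T ⟶ X) :
    f.tr (f.untr x) = x := by simp [tr, untr]

@[simp] lemma untr_tr (f : GeometricMorphism E E') {T : E'} {X : E} (x : T ⟶ f.direct.obj X) :
    f.untr (f.tr x) = x := by simp [tr, untr]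

lemma tr_precomp (f : GeometricMorphism E E') {S T : E'} {X : E} (a : S ⟶ T)
    (x : T ⟶ f.direct.obj X) : f.tr (a ≫ x) = f.inverse.map a ≫ f.tr x := by
  simp [tr, Adjunction.homEquiv_naturality_left_symm]

lemma tr_postcomp (f : GeometricMorphism E E') {T : E'} {X Y : E} (x : T ⟶ f.direct.obj X)
    (b : X ⟶ Y) : f.tr (x ≫ f.direct.map b) = f.tr x ≫ b := by
  simp [tr, Adjunction.homEquiv_naturality_right_symm]

end GeometricMorphism

/-! ## Internal posets and internal frames -/

/-- A partially ordered object: an object `X` with a subobject of `X ⨯ X` which makes every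
`Hom(T, X)` a partially ordered set. -/
structure InternalPoset (E : Type u) [Category.{v} E] [HasFiniteLimits E] where
  carrier : E
  rel : Subobject (carrier ⨯ carrier)
  rel_refl : ∀ ⦃T : E⦄ (x : T ⟶ carrier), rel.Factors (prod.lift x x)
  rel_trans : ∀ ⦃T : E⦄ (x y z : T ⟶ carrier),
    rel.Factors (prod.lift x y) → rel.Factors (prod.lift y z) → rel.Factors (prod.lift x z)
  rel_antisymm : ∀ ⦃T : E⦄ (x y : T ⟶ carrier),
    rel.Factors (prod.lift x y) → rel.Factors (prod.lift y x) → x = y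

namespace InternalPoset

variable {E : Type u} [Category.{v} E] [HasFiniteLimits E] (X : InternalPoset E)

/-- The order on generalized elements `T ⟶ X`. -/
def le {T : E} (x y : T ⟶ X.carrier) : Prop := X.rel.Factors (prod.lift x y)

/-- `t` is, at all later stages, the greatest element of `X`. -/
def IsTop {T : E} (t : T ⟶ X.carrier) : Prop :=
  ∀ ⦃T' : E⦄ (α : T' ⟶ T) (z : T' ⟶ X.carrier), X.le z (α ≫ t)

/-- `m` is, at all later stages, the meet of `x` and `y`. -/
def IsMeet {T : E} (x y m : T ⟶ X.carrier) : Prop :=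
  ∀ ⦃T' : E⦄ (α : T' ⟶ T) (z : T' ⟶ X.carrier),
    X.le z (α ≫ m) ↔ X.le z (α ≫ x) ∧ X.le z (α ≫ y)

/-- An object `e : I ⟶ T` over `T` and a morphism `q : I ⟶ X` are an internal family
`(q i)_{i ∈ I_t}` of elements of `X`, with parameter `t ∈ T`.  The generalized element `s` is its
internal join `t ↦ ⋁_{i ∈ I_t} q i`: at all later stages `s ≤ y` if and only if
`q i ≤ y` for all `i` in the fibre.  (If `I ⊂ T ⨯ X` with `q` the projection, that is,
a generalized element of the power object of `X`, this is the join of an internal subset.) -/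
def IsJoin {I T : E} (e : I ⟶ T) (q : I ⟶ X.carrier) (s : T ⟶ X.carrier) : Prop :=
  ∀ ⦃T' : E⦄ (α : T' ⟶ T) (y : T' ⟶ X.carrier),
    X.le (α ≫ s) y ↔
      ∀ ⦃T'' : E⦄ (β : T'' ⟶ T') (i : T'' ⟶ I), i ≫ e = β ≫ α → X.le (i ≫ q) (β ≫ y)

variable {X}

lemma le_refl {T : E} (x : T ⟶ X.carrier) : X.le x x := X.rel_refl x

lemma le_trans {T : E} {x y z : T ⟶ X.carrier} (h : X.le x y) (h' : X.le y z) : X.le x z :=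
  X.rel_trans x y z h h'

lemma le_antisymm {T : E} {x y : T ⟶ X.carrier} (h : X.le x y) (h' : X.le y x) : x = y :=
  X.rel_antisymm x y h h'

lemma le_precomp {S T : E} (a : S ⟶ T) {x y : T ⟶ X.carrier} (h : X.le x y) :
    X.le (a ≫ x) (a ≫ y) := by
  have := Subobject.factors_of_factors_right (P := X.rel) a h
  rwa [prod.comp_lift] at this

lemma IsTop.unique {T : E} {t t' : T ⟶ X.carrier} (h : X.IsTop t) (h' : X.IsTop t') : t = t' := by
  refine le_antisymm ?_ ?_
  · simpa using h' (𝟙 T) t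
  · simpa using h (𝟙 T) t'

lemma IsMeet.unique {T : E} {x y m m' : T ⟶ X.carrier} (h : X.IsMeet x y m)
    (h' : X.IsMeet x y m') : m = m' := by
  refine le_antisymm ?_ ?_
  · have := (h' (𝟙 T) m).2 ((h (𝟙 T) m).1 (by simpa using le_refl m)); simpa using this
  · have := (h (𝟙 T) m').2 ((h' (𝟙 T) m').1 (by simpa using le_refl m')); simpa using this

lemma IsJoin.unique {I T : E} {e : I ⟶ T} {q : I ⟶ X.carrier} {s s' : T ⟶ X.carrier}
    (h : X.IsJoin e q s) (h' : X.IsJoin e q s') : s = s' := by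
  refine le_antisymm ?_ ?_
  · have := (h (𝟙 T) s').2 ((h' (𝟙 T) s').1 (by simpa using le_refl s')); simpa using this
  · have := (h' (𝟙 T) s).2 ((h (𝟙 T) s).1 (by simpa using le_refl s)); simpa using this

end InternalPoset

/-- An internal frame: a partially ordered object with finite meets and with joins of all internal
families, such that binary meets distribute over joins. -/
structure InternalFrame (E : Type u) [Category.{v} E] [HasFiniteLimits E] extends
    InternalPoset E where
  exists_top : ∀ T : E, ∃ t : T ⟶ carrier, toInternalPoset.IsTop t
  exists_meet : ∀ ⦃T : E⦄ (x y : T ⟶ carrier), ∃ m, toInternalPoset.IsMeet x y m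
  exists_join : ∀ ⦃I T : E⦄ (e : I ⟶ T) (q : I ⟶ carrier), ∃ s, toInternalPoset.IsJoin e q s
  distrib : ∀ ⦃I T : E⦄ (e : I ⟶ T) (q r : I ⟶ carrier) (s a m : T ⟶ carrier),
    toInternalPoset.IsJoin e q s → toInternalPoset.IsMeet a s m →
      toInternalPoset.IsMeet (e ≫ a) q r → toInternalPoset.IsJoin e r m

namespace InternalFrame

section

variable {E : Type u} [Category.{v} E] [HasFiniteLimits E]

/-- A homomorphism of internal frames: a morphism which preserves finite meets and
internal joins. -/
@[ext]
structure Hom (X Y : InternalFrame E) where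
  hom : X.carrier ⟶ Y.carrier
  map_top : ∀ ⦃T : E⦄ (t : T ⟶ X.carrier), X.IsTop t → Y.IsTop (t ≫ hom)
  map_meet : ∀ ⦃T : E⦄ (x y m : T ⟶ X.carrier), X.IsMeet x y m →
    Y.IsMeet (x ≫ hom) (y ≫ hom) (m ≫ hom)
  map_join : ∀ ⦃I T : E⦄ (e : I ⟶ T) (q : I ⟶ X.carrier) (s : T ⟶ X.carrier),
    X.IsJoin e q s → Y.IsJoin e (q ≫ hom) (s ≫ hom)

/-- The category of internal frames in `E`. -/
instance : Category (InternalFrame E) where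
  Hom := Hom
  id X :=
    { hom := 𝟙 _
      map_top := fun T t h => by simpa using h
      map_meet := fun T x y m h => by simpa using h
      map_join := fun I T e q s h => by simpa using h }
  comp f g :=
    { hom := f.hom ≫ g.hom
      map_top := fun T t h => by simpa using g.map_top _ (f.map_top _ h)
      map_meet := fun T x y m h => by simpa using g.map_meet _ _ _ (f.map_meet _ _ _ h)
      map_join := fun I T e q s h => by simpa using g.map_join _ _ _ (f.map_join _ _ _ h) }
  id_comp f := Hom.ext (Category.id_comp _)
  comp_id f := Hom.ext (Category.comp_id _)
  assoc f g h := Hom.ext (Category.assoc _ _ _)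

@[simp] lemma id_hom (X : InternalFrame E) : Hom.hom (𝟙 X) = 𝟙 X.carrier := rfl

@[simp] lemma comp_hom {X Y Z : InternalFrame E} (f : X ⟶ Y) (g : Y ⟶ Z) :
    Hom.hom (f ≫ g) = Hom.hom f ≫ Hom.hom g := rfl

@[ext] lemma hom_ext {X Y : InternalFrame E} {f g : X ⟶ Y} (h : Hom.hom f = Hom.hom g) : f = g :=
  Hom.ext h

/-- An isomorphism of the carriers which preserves and reflects the order is a homomorphism of
internal frames. -/
def Hom.ofLeIff (X Y : InternalFrame E) (i : X.carrier ⟶ Y.carrier) [IsIso i]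
    (h : ∀ ⦃T : E⦄ (x y : T ⟶ X.carrier), X.le x y ↔ Y.le (x ≫ i) (y ≫ i)) : X ⟶ Y where
  hom := i
  map_top T t ht T' α z := by
    have := (h _ _).1 (ht α (z ≫ inv i))
    simpa using this
  map_meet T x y m hm T' α z := by
    have := hm α (z ≫ inv i)
    simpa [h] using this
  map_join I T e q s hs T' α y := by
    have := hs α (y ≫ inv i)
    simpa [h] using this

end

section pushforward

variable {E : Type u₁} [Category.{v₁} E] [HasFiniteLimits E]
  {E' : Type u₂} [Category.{v₂} E'] [HasFiniteLimits E']
  {E'' : Type u₃} [Category.{v₃} E''] [HasFiniteLimits E'']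

/-- The subobject `f_*(≤) ⊂ f_* (X ⨯ X) ≅ f_* X ⨯ f_* X`. -/
noncomputable def pushRel (f : GeometricMorphism E E') (X : InternalPoset E) :
    Subobject (f.direct.obj X.carrier ⨯ f.direct.obj X.carrier) :=
  have : PreservesLimits f.direct := f.adj.rightAdjoint_preservesLimits
  Subobject.mk (f.direct.map X.rel.arrow ≫ prodComparison f.direct X.carrier X.carrier)

lemma pushRel_factors (f : GeometricMorphism E E') (X : InternalPoset E) {T : E'}
    (x y : T ⟶ f.direct.obj X.carrier) :
    (pushRel f X).Factors (prod.lift x y) ↔ X.le (f.tr x) (f.tr y) := by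
  have : PreservesLimits f.direct := f.adj.rightAdjoint_preservesLimits
  unfold pushRel InternalPoset.le
  rw [Subobject.mk_factors_iff]
  constructor
  · rintro ⟨g, hg⟩
    change T ⟶ f.direct.obj (X.rel : E) at g
    change g ≫ f.direct.map X.rel.arrow ≫ prodComparison f.direct X.carrier X.carrier =
      prod.lift x y at hg
    have h1 := congrArg (· ≫ prod.fst) hg
    have h2 := congrArg (· ≫ prod.snd) hg
    simp only [Category.assoc, prodComparison_fst, prodComparison_snd,
      prod.lift_fst, prod.lift_snd, ← Functor.map_comp] at h1 h2
    have : prod.lift (f.tr x) (f.tr y) = f.tr g ≫ X.rel.arrow := by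
      ext
      · rw [prod.lift_fst, ← h1, f.tr_postcomp g, Category.assoc]
      · rw [prod.lift_snd, ← h2, f.tr_postcomp g, Category.assoc]
    rw [this]
    exact Subobject.factors_comp_arrow _
  · intro h
    have key : ∀ (p : X.carrier ⨯ X.carrier ⟶ X.carrier),
        f.untr (X.rel.factorThru _ h) ≫ f.direct.map (X.rel.arrow ≫ p) =
          f.untr (prod.lift (f.tr x) (f.tr y) ≫ p) := by
      intro p
      rw [← f.untr_tr (_ ≫ f.direct.map _), f.tr_postcomp, f.tr_untr]
      simp
    refine ⟨f.untr (X.rel.factorThru _ h), ?_⟩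
    change f.untr (X.rel.factorThru _ h) ≫ f.direct.map X.rel.arrow ≫
      prodComparison f.direct X.carrier X.carrier = prod.lift x y
    ext
    · rw [Category.assoc, Category.assoc, prodComparison_fst, prod.lift_fst, ← Functor.map_comp]
      exact (key prod.fst).trans (by rw [prod.lift_fst, f.untr_tr])
    · rw [Category.assoc, Category.assoc, prodComparison_snd, prod.lift_snd, ← Functor.map_comp]
      exact (key prod.snd).trans (by rw [prod.lift_snd, f.untr_tr])

/-- The direct image `(f_* X, f_*(≤))` of a partially ordered object. -/
noncomputable abbrev pushPoset (f : GeometricMorphism E E') (X : InternalPoset E) :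
    InternalPoset E' where
  carrier := f.direct.obj X.carrier
  rel := pushRel f X
  rel_refl T x := (pushRel_factors f X _ _).2 (InternalPoset.le_refl _)
  rel_trans T x y z h h' := (pushRel_factors f X _ _).2
    (InternalPoset.le_trans ((pushRel_factors f X _ _).1 h) ((pushRel_factors f X _ _).1 h'))
  rel_antisymm T x y h h' := by
    have := InternalPoset.le_antisymm ((pushRel_factors f X _ _).1 h)
      ((pushRel_factors f X _ _).1 h')
    rw [← f.untr_tr x, this, f.untr_tr]

section

variable (f : GeometricMorphism E E') (X : InternalFrame E)

lemma push_le {T : E'} (x y : T ⟶ f.direct.obj X.carrier) :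
    (pushPoset f X.toInternalPoset).le x y ↔ X.le (f.tr x) (f.tr y) :=
  pushRel_factors f X.toInternalPoset x y

lemma push_isTop_of {T : E'} {t : T ⟶ f.direct.obj X.carrier} (h : X.IsTop (f.tr t)) :
    (pushPoset f X.toInternalPoset).IsTop t := by
  intro T' α z
  refine (push_le f X _ _).2 ?_
  rw [f.tr_precomp]
  exact h _ _

lemma push_isMeet_of {T : E'} {x y m : T ⟶ f.direct.obj X.carrier}
    (h : X.IsMeet (f.tr x) (f.tr y) (f.tr m)) :
    (pushPoset f X.toInternalPoset).IsMeet x y m := by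
  intro T' α z
  refine (push_le f X _ _).trans (Iff.trans ?_
    (and_congr (push_le f X _ _).symm (push_le f X _ _).symm))
  rw [f.tr_precomp, f.tr_precomp, f.tr_precomp]
  exact h _ _

lemma push_isJoin_of {I T : E'} {e : I ⟶ T} {q : I ⟶ f.direct.obj X.carrier}
    {s : T ⟶ f.direct.obj X.carrier}
    (h : X.IsJoin (f.inverse.map e) (f.tr q) (f.tr s)) :
    (pushPoset f X.toInternalPoset).IsJoin e q s := by
  intro T' α y
  refine (push_le f X _ _).trans ?_
  rw [f.tr_precomp]
  refine (h _ _).trans ⟨?_, ?_⟩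
  · intro H T'' β i hi
    refine (push_le f X _ _).2 ?_
    rw [f.tr_precomp, f.tr_precomp]
    refine H _ _ ?_
    rw [← Functor.map_comp, ← Functor.map_comp, hi]
  · intro H S β i hi
    have h1 := (push_le f X _ _).1 (H (pullback.snd e α) (pullback.fst e α) pullback.condition)
    rw [f.tr_precomp, f.tr_precomp] at h1
    have hp : IsPullback (f.inverse.map (pullback.fst e α)) (f.inverse.map (pullback.snd e α))
        (f.inverse.map e) (f.inverse.map α) := (IsPullback.of_hasPullback e α).map f.inverse
    have h2 := InternalPoset.le_precomp (hp.lift i β hi) h1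
    rwa [← Category.assoc, ← Category.assoc, hp.lift_fst, hp.lift_snd] at h2

lemma push_isTop_iff {T : E'} {t : T ⟶ f.direct.obj X.carrier} :
    (pushPoset f X.toInternalPoset).IsTop t ↔ X.IsTop (f.tr t) := by
  refine ⟨fun h => ?_, push_isTop_of f X⟩
  obtain ⟨t', ht'⟩ := X.exists_top (f.inverse.obj T)
  have : (pushPoset f X.toInternalPoset).IsTop (f.untr t') :=
    push_isTop_of f X (by simpa using ht')
  rw [h.unique this]
  simpa using ht'

lemma push_isMeet_iff {T : E'} {x y m : T ⟶ f.direct.obj X.carrier} :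
    (pushPoset f X.toInternalPoset).IsMeet x y m ↔ X.IsMeet (f.tr x) (f.tr y) (f.tr m) := by
  refine ⟨fun h => ?_, push_isMeet_of f X⟩
  obtain ⟨t', ht'⟩ := X.exists_meet (f.tr x) (f.tr y)
  have : (pushPoset f X.toInternalPoset).IsMeet x y (f.untr t') :=
    push_isMeet_of f X (by simpa using ht')
  rw [h.unique this]
  simpa using ht'

lemma push_isJoin_iff {I T : E'} {e : I ⟶ T} {q : I ⟶ f.direct.obj X.carrier}
    {s : T ⟶ f.direct.obj X.carrier} :
    (pushPoset f X.toInternalPoset).IsJoin e q s ↔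
      X.IsJoin (f.inverse.map e) (f.tr q) (f.tr s) := by
  refine ⟨fun h => ?_, push_isJoin_of f X⟩
  obtain ⟨t', ht'⟩ := X.exists_join (f.inverse.map e) (f.tr q)
  have : (pushPoset f X.toInternalPoset).IsJoin e q (f.untr t') :=
    push_isJoin_of f X (by simpa using ht')
  rw [h.unique this]
  simpa using ht'

end

/-- The direct image of an internal frame along a geometric morphism. -/
noncomputable abbrev pushforwardObj (f : GeometricMorphism E E') (X : InternalFrame E) :
    InternalFrame E' where
  toInternalPoset := pushPoset f X.toInternalPoset
  exists_top T := by
    obtain ⟨t', ht'⟩ := X.exists_top (f.inverse.obj T)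
    exact ⟨f.untr t', push_isTop_of f X (by simpa using ht')⟩
  exists_meet T x y := by
    obtain ⟨t', ht'⟩ := X.exists_meet (f.tr x) (f.tr y)
    exact ⟨f.untr t', push_isMeet_of f X (by simpa using ht')⟩
  exists_join I T e q := by
    obtain ⟨t', ht'⟩ := X.exists_join (f.inverse.map e) (f.tr q)
    exact ⟨f.untr t', push_isJoin_of f X (by simpa using ht')⟩
  distrib I T e q r s a m hs hm hr := by
    refine push_isJoin_of f X (X.distrib _ _ _ _ (f.tr a) _ ((push_isJoin_iff f X).1 hs)
      ((push_isMeet_iff f X).1 hm) ?_)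
    rw [← f.tr_precomp]
    exact (push_isMeet_iff f X).1 hr

/-- The direct image functor on internal frames along a geometric morphism. -/
noncomputable abbrev pushforward (f : GeometricMorphism E E') :
    InternalFrame E ⥤ InternalFrame E' where
  obj := pushforwardObj f
  map {X Y} φ :=
    { hom := f.direct.map (Hom.hom φ)
      map_top := fun T t h => by
        refine push_isTop_of f Y ?_
        rw [f.tr_postcomp]
        exact φ.map_top _ ((push_isTop_iff f X).1 h)
      map_meet := fun T x y m h => by
        refine push_isMeet_of f Y ?_
        rw [f.tr_postcomp, f.tr_postcomp, f.tr_postcomp]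
        exact φ.map_meet _ _ _ ((push_isMeet_iff f X).1 h)
      map_join := fun I T e q s h => by
        refine push_isJoin_of f Y ?_
        rw [f.tr_postcomp, f.tr_postcomp]
        exact φ.map_join _ _ _ ((push_isJoin_iff f X).1 h) }
  map_id X := Hom.ext (f.direct.map_id _)
  map_comp φ ψ := Hom.ext (f.direct.map_comp _ _)

/-- Direct image along the identity is the identity. -/
noncomputable def pushforwardId (X : InternalFrame E) :
    X ⟶ (pushforward (GeometricMorphism.id E)).obj X :=
  Hom.ofLeIff X ((pushforward (GeometricMorphism.id E)).obj X) (𝟙 X.carrier) (fun T x y => by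
    refine Iff.trans ?_ (push_le (GeometricMorphism.id E) X _ _).symm
    rw [Category.comp_id, Category.comp_id]
    have h : ∀ z : T ⟶ X.carrier, (GeometricMorphism.id E).tr (X := X.carrier) z = z := by
      intro z
      refine (Equiv.symm_apply_eq _).2 ?_
      rw [Adjunction.homEquiv_unit]
      exact (Category.id_comp z).symm
    erw [h, h])

/-- Direct image along a composite is the composite of the direct images. -/
noncomputable def pushforwardComp (f : GeometricMorphism E E') (g : GeometricMorphism E' E'')
    (X : InternalFrame E) :
    (pushforward g).obj ((pushforward f).obj X) ⟶ (pushforward (f.comp g)).obj X :=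
  Hom.ofLeIff ((pushforward g).obj ((pushforward f).obj X)) ((pushforward (f.comp g)).obj X)
    (𝟙 (g.direct.obj (f.direct.obj X.carrier))) (fun T x y => by
      refine (push_le g ((pushforward f).obj X) _ _).trans ?_
      refine (push_le f X _ _).trans (Iff.trans ?_ (push_le (f.comp g) X _ _).symm)
      have h : ∀ z : T ⟶ g.direct.obj (f.direct.obj X.carrier),
          (f.comp g).tr (X := X.carrier) z = f.tr (g.tr z) := by
        intro z
        simp only [GeometricMorphism.tr, GeometricMorphism.comp, Adjunction.comp_homEquiv]
        rfl
      erw [Category.comp_id, Category.comp_id, h, h])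

/-- `G`, with the universal arrow `η : F' ⟶ f_* G`, is the value `f^♯ F'` at `F'` of the
left adjoint of the direct image functor on internal frames. -/
def IsSharp (f : GeometricMorphism E E') (F' : InternalFrame E') (G : InternalFrame E)
    (η : F' ⟶ (pushforward f).obj G) : Prop :=
  ∀ (H : InternalFrame E) (k : F' ⟶ (pushforward f).obj H),
    ∃! l : G ⟶ H, η ≫ (pushforward f).map l = k

end pushforward

end InternalFrame

/-! ## Framed topoi -/

set_option linter.checkUnivs false in
/-- A framed topos: a topos with an internal frame. -/
structure FramedTopos where
  topos : Type u
  [category : Category.{v} topos]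
  [isTopos : IsTopos topos]
  frame : InternalFrame topos

namespace FramedTopos

attribute [instance] FramedTopos.category FramedTopos.isTopos

/-- A geometric morphism `f : E → E'` with a homomorphism `f^♯ F' ⟶ F` of internal frames in `E`,
given by its transpose `F' ⟶ f_* F` under the adjunction `f^♯ ⊣ f_*`. -/
structure PreHom (A B : FramedTopos.{v, u}) where
  geom : GeometricMorphism A.topos B.topos
  sharp : B.frame ⟶ (InternalFrame.pushforward geom).obj A.frame

/-- Isomorphism of framed geometric morphisms: a natural isomorphism of the direct image functors
(equivalently, of the inverse image functors) compatible with the frame homomorphisms. -/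
def PreHom.Iso {A B : FramedTopos.{v, u}} (f g : PreHom A B) : Prop :=
  ∃ θ : f.geom.direct ≅ g.geom.direct,
    InternalFrame.Hom.hom f.sharp ≫ θ.hom.app A.frame.carrier = InternalFrame.Hom.hom g.sharp

instance preHomSetoid (A B : FramedTopos.{v, u}) : Setoid (PreHom A B) where
  r := PreHom.Iso
  iseqv :=
    { refl := fun f => ⟨Iso.refl _, by erw [NatTrans.id_app, Category.comp_id]⟩
      symm := by
        rintro f g ⟨θ, h⟩
        refine ⟨θ.symm, ?_⟩
        rw [← h, Category.assoc]
        erw [Iso.hom_inv_id_app, Category.comp_id]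
      trans := by
        rintro f g k ⟨θ, h⟩ ⟨η, h'⟩
        refine ⟨θ ≪≫ η, ?_⟩
        rw [← h', ← h, Category.assoc]
        rfl }

/-- The identity of a framed topos. -/
noncomputable abbrev PreHom.id (A : FramedTopos.{v, u}) : PreHom A A where
  geom := GeometricMorphism.id A.topos
  sharp := InternalFrame.pushforwardId A.frame

/-- The composite of `f` and `g`, with frame part `F'' ⟶ g_* F' ⟶ g_* f_* F`. -/
noncomputable abbrev PreHom.comp {A B C : FramedTopos.{v, u}} (f : PreHom A B) (g : PreHom B C) :
    PreHom A C where
  geom := f.geom.comp g.geom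
  sharp := g.sharp ≫ (InternalFrame.pushforward g.geom).map f.sharp ≫
    InternalFrame.pushforwardComp f.geom g.geom A.frame

lemma PreHom.comp_sharp_hom {A B C : FramedTopos.{v, u}} (f : PreHom A B) (g : PreHom B C) :
    InternalFrame.Hom.hom (f.comp g).sharp =
      InternalFrame.Hom.hom g.sharp ≫ g.geom.direct.map (InternalFrame.Hom.hom f.sharp) := by
  change InternalFrame.Hom.hom g.sharp ≫ g.geom.direct.map (InternalFrame.Hom.hom f.sharp) ≫
    𝟙 _ = _
  rw [Category.comp_id]

/-- The category of framed topoi.  Morphisms are geometric morphisms `f : E → E'` with a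
homomorphism `f^♯ F' ⟶ F` of internal frames, up to isomorphism of geometric morphisms. -/
noncomputable instance : Category (FramedTopos.{v, u}) where
  Hom A B := Quotient (preHomSetoid A B)
  id A := Quotient.mk _ (PreHom.id A)
  comp {A B C} := Quotient.map₂ PreHom.comp (by
    rintro f f' ⟨θ, h⟩ g g' ⟨η, h'⟩
    refine ⟨NatIso.hcomp θ η, ?_⟩
    rw [PreHom.comp_sharp_hom, PreHom.comp_sharp_hom, ← h, ← h']
    change (_ ≫ _) ≫ (η.hom.app _ ≫ g'.geom.direct.map (θ.hom.app _)) = _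
    simp only [Functor.map_comp, Category.assoc]
    erw [η.hom.naturality_assoc])
  id_comp := by
    rintro A B ⟨f⟩
    refine Quotient.sound ⟨Functor.leftUnitor _, ?_⟩
    rw [PreHom.comp_sharp_hom]
    change (_ ≫ f.geom.direct.map (𝟙 _)) ≫ 𝟙 _ = _
    rw [Category.comp_id, CategoryTheory.Functor.map_id, Category.comp_id]
  comp_id := by
    rintro A B ⟨f⟩
    refine Quotient.sound ⟨Functor.rightUnitor _, ?_⟩
    rw [PreHom.comp_sharp_hom]
    change (𝟙 _ ≫ InternalFrame.Hom.hom f.sharp) ≫ 𝟙 _ = _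
    rw [Category.comp_id, Category.id_comp]
  assoc := by
    rintro A B C D ⟨f⟩ ⟨g⟩ ⟨h⟩
    refine Quotient.sound ⟨Functor.associator _ _ _, ?_⟩
    rw [PreHom.comp_sharp_hom, PreHom.comp_sharp_hom, PreHom.comp_sharp_hom,
      PreHom.comp_sharp_hom]
    change _ ≫ 𝟙 _ = _
    rw [Category.comp_id, Functor.map_comp, Category.assoc]
    rfl

/-- The morphism of framed topoi represented by a framed geometric morphism. -/
noncomputable def homMk {A B : FramedTopos.{v, u}} (f : PreHom A B) : A ⟶ B :=
  Quotient.mk (preHomSetoid A B) f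

end FramedTopos

/-! ## Kripke topoi -/

section Kripke

/-- The two binary products agree. -/
noncomputable def tensorIsoProd {E : Type u} [Category.{v} E] [CartesianMonoidalCategory E]
    [HasFiniteProducts E] (X Y : E) : MonoidalCategoryStruct.tensorObj X Y ≅ X ⨯ Y where
  hom := prod.lift (SemiCartesianMonoidalCategory.fst X Y) (SemiCartesianMonoidalCategory.snd X Y)
  inv := CartesianMonoidalCategory.lift prod.fst prod.snd
  hom_inv_id := by
    apply CartesianMonoidalCategory.hom_ext <;> simp [prod.lift_fst, prod.lift_snd]
  inv_hom_id := by apply Limits.prod.hom_ext <;> simp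

/-- The two product functors agree. -/
noncomputable def tensorLeftIsoProd {E : Type u} [Category.{v} E] [CartesianMonoidalCategory E]
    [HasFiniteProducts E] (X : E) : MonoidalCategory.tensorLeft X ≅ prod.functor.obj X :=
  NatIso.ofComponents (fun Y => tensorIsoProd X Y) (by
    intro Y Z g
    change MonoidalCategoryStruct.whiskerLeft X g ≫ prod.lift _ _ =
      prod.lift _ _ ≫ prod.map (𝟙 X) g
    apply Limits.prod.hom_ext <;> simp)

/-- The Kripke topos `Set^C` of a partially ordered set. -/
instance kripkeTopos (C : Type u) [PartialOrder C] : IsTopos (C ⥤ Type u) where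
  hasFiniteLimits := inferInstance
  hasFiniteColimits := inferInstance
  hasExponentials X := by
    have : (MonoidalCategory.tensorLeft X).IsLeftAdjoint := inferInstance
    refine Functor.isLeftAdjoint_of_iso (F := MonoidalCategory.tensorLeft X) ?_
    exact tensorLeftIsoProd X
  hasSubobjectClassifier := by
    have : HasSubobjectClassifier ((Cᵒᵖ)ᵒᵖ ⥤ Type u) := inferInstance
    exact ⟨⟨this.exists_classifier.some.ofEquivalence
      (Equivalence.congrLeft (E := Type u) (opOpEquivalence C))⟩⟩

/-- The geometric morphism `Set^C → Set^C'` of an isotone map `φ : C → C'`: the inverse image is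
precomposition with `φ`, the direct image is the right Kan extension
`(φ_* F)(c') = lim_{c' ≤ φ c} F c`. -/
noncomputable def kripkeMap {C C' : Type u} [PartialOrder C] [PartialOrder C'] (φ : C →o C') :
    GeometricMorphism (C ⥤ Type u) (C' ⥤ Type u) where
  direct := φ.monotone.functor.ran
  inverse := (Functor.whiskeringLeft C C' (Type u)).obj φ.monotone.functor
  adj := φ.monotone.functor.ranAdjunction (Type u)
  preserves := inferInstance

end Kripke

/-! ## Ideal completion in a Kripke topos -/

section IdealCompletion

variable {C : Type u} [PartialOrder C]

/-- An element of `(Idl D)(c)`: a subfunctor `J` of `D` restricted to `{d | c ≤ d}` such that every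
`J d ⊂ D d` is an order ideal. -/
@[ext]
structure IdealSection (D : C ⥤ BddDistLat.{u}) (c : C) where
  ideal : ∀ d : C, c ≤ d → Order.Ideal (D.obj d)
  map_mem : ∀ (d d' : C) (h : c ≤ d) (h' : d ≤ d') (x : D.obj d),
    x ∈ ideal d h → D.map (homOfLE h') x ∈ ideal d' (h.trans h')

namespace IdealSection

variable {D : C ⥤ BddDistLat.{u}}

/-- Ideal sections are ordered by inclusion. -/
instance (c : C) : PartialOrder (IdealSection D c) where
  le J K := ∀ d h, J.ideal d h ≤ K.ideal d h
  le_refl J d h := le_rfl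
  le_trans J K L h h' d hd := (h d hd).trans (h' d hd)
  le_antisymm J K h h' := by
    ext1
    funext d hd
    exact le_antisymm (h d hd) (h' d hd)

/-- Restriction of an ideal section to a later stage. -/
def restrict {c c' : C} (h : c ≤ c') (J : IdealSection D c) : IdealSection D c' where
  ideal d hd := J.ideal d (h.trans hd)
  map_mem d d' hd hd' x hx := J.map_mem d d' (h.trans hd) hd' x hx

variable (D) in
/-- The principal ideal section `d ↦ ↓ D(c → d) x` generated by `x ∈ D c`. -/
def principal (c : C) (x : D.obj c) : IdealSection D c where
  ideal d h := Order.Ideal.principal (D.map (homOfLE h) x)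
  map_mem d d' h h' y hy := by
    rw [Order.Ideal.mem_principal] at hy ⊢
    have := OrderHomClass.mono (D.map (homOfLE h')).hom hy
    refine le_trans this (le_of_eq ?_)
    rw [← homOfLE_comp h h', D.map_comp]
    rfl

end IdealSection

variable (D : C ⥤ BddDistLat.{u})

/-- The underlying object of the internal ideal completion. -/
def idlFunctor : C ⥤ Type u where
  obj c := IdealSection D c
  map f := ↾(IdealSection.restrict (leOfHom f))
  map_id _ := rfl
  map_comp _ _ := rfl

variable {D} in
/-- The value of a generalized element of the ideal completion. -/
def sec {T : C ⥤ Type u} (x : T ⟶ idlFunctor D) (c : C) (t : T.obj c) : IdealSection D c :=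
  x.app c t

variable {D} in
lemma sec_map {T : C ⥤ Type u} (x : T ⟶ idlFunctor D) {c d : C} (f : c ⟶ d) (t : T.obj c) :
    sec x d (T.map f t) = (sec x c t).restrict (leOfHom f) :=
  NatTrans.naturality_apply x f t

variable {D} in
lemma sec_ext {T : C ⥤ Type u} {x y : T ⟶ idlFunctor D} (h : ∀ c t, sec x c t = sec y c t) :
    x = y := by
  ext c t
  exact h c t

/-- The order relation of the internal ideal completion, as a functor. -/
def idlRelFunctor : C ⥤ Type u where
  obj c := { p : IdealSection D c × IdealSection D c // p.1 ≤ p.2 }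
  map f := ↾(fun p => ⟨(p.1.1.restrict (leOfHom f), p.1.2.restrict (leOfHom f)),
    fun d _ => p.2 d _⟩)
  map_id _ := rfl
  map_comp _ _ := rfl

/-- The first projection of the order relation. -/
def idlRelFst : idlRelFunctor D ⟶ idlFunctor D where
  app _ := ↾(fun p => p.1.1)
  naturality _ _ _ := rfl

/-- The second projection of the order relation. -/
def idlRelSnd : idlRelFunctor D ⟶ idlFunctor D where
  app _ := ↾(fun p => p.1.2)
  naturality _ _ _ := rfl

lemma idlRel_ext {T : C ⥤ Type u} {g h : T ⟶ idlRelFunctor D}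
    (h1 : g ≫ idlRelFst D = h ≫ idlRelFst D) (h2 : g ≫ idlRelSnd D = h ≫ idlRelSnd D) :
    g = h := by
  ext c t
  refine Subtype.ext (Prod.ext ?_ ?_)
  · exact congrArg (fun k : T ⟶ idlFunctor D => k.app c t) h1
  · exact congrArg (fun k : T ⟶ idlFunctor D => k.app c t) h2

instance : Mono (prod.lift (idlRelFst D) (idlRelSnd D)) where
  right_cancellation g h w := by
    have h1 := congrArg (· ≫ prod.fst) w
    have h2 := congrArg (· ≫ prod.snd) w
    simp only [Category.assoc, prod.lift_fst, prod.lift_snd] at h1 h2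
    exact idlRel_ext D h1 h2

lemma idlRel_factors {T : C ⥤ Type u} (x y : T ⟶ idlFunctor D) :
    (Subobject.mk (prod.lift (idlRelFst D) (idlRelSnd D))).Factors (prod.lift x y) ↔
      ∀ (c : C) (t : T.obj c), sec x c t ≤ sec y c t := by
  rw [Subobject.mk_factors_iff]
  constructor
  · rintro ⟨g, hg⟩ c t
    change T ⟶ idlRelFunctor D at g
    change g ≫ prod.lift (idlRelFst D) (idlRelSnd D) = _ at hg
    have h1 := congrArg (· ≫ prod.fst) hg
    have h2 := congrArg (· ≫ prod.snd) hg
    simp only [Category.assoc, prod.lift_fst, prod.lift_snd] at h1 h2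
    subst h1 h2
    exact (show { p : IdealSection D c × IdealSection D c // p.1 ≤ p.2 } from g.app c t).2
  · intro h
    let g : T ⟶ idlRelFunctor D :=
      { app := fun c => ↾(fun t => ⟨(x.app c t, y.app c t), h c t⟩)
        naturality := fun c d f => by
          ext t
          refine Subtype.ext (Prod.ext ?_ ?_)
          · exact NatTrans.naturality_apply x f t
          · exact NatTrans.naturality_apply y f t }
    refine ⟨g, ?_⟩
    change g ≫ prod.lift (idlRelFst D) (idlRelSnd D) = _
    rw [prod.comp_lift]
    rfl

/-- The internal ideal completion of `D`, as a partially ordered object. -/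
noncomputable abbrev idlPoset : InternalPoset (C ⥤ Type u) where
  carrier := idlFunctor D
  rel := Subobject.mk (prod.lift (idlRelFst D) (idlRelSnd D))
  rel_refl T x := (idlRel_factors D _ _).2 fun c t => le_rfl
  rel_trans T x y z h h' := (idlRel_factors D _ _).2 fun c t =>
    ((idlRel_factors D _ _).1 h c t).trans ((idlRel_factors D _ _).1 h' c t)
  rel_antisymm T x y h h' := by
    refine sec_ext fun c t => ?_
    exact le_antisymm ((idlRel_factors D _ _).1 h c t) ((idlRel_factors D _ _).1 h' c t)

lemma idl_le {T : C ⥤ Type u} (x y : T ⟶ idlFunctor D) :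
    (idlPoset D).le x y ↔
      ∀ (c : C) (t : T.obj c), sec x c t ≤ sec y c t :=
  idlRel_factors D x y

/-- Binary meets distribute over joins of ideals of a distributive lattice. -/
lemma ideal_inf_sSup_le {L : Type*} [DistribLattice L] [BoundedOrder L] (A Y : Order.Ideal L)
    (Q : Set (Order.Ideal L)) (h : ∀ q ∈ Q, A ⊓ q ≤ Y) : A ⊓ sSup Q ≤ Y := by
  let Z : Order.Ideal L := Order.IsIdeal.toIdeal (I := { x | ∀ a ∈ A, a ⊓ x ∈ Y })
    { IsLowerSet := fun x y hyx hx a ha => Y.lower (inf_le_inf_left a hyx) (hx a ha)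
      Nonempty := ⟨⊥, fun a _ => by simp⟩
      Directed := fun x hx y hy => ⟨x ⊔ y, fun a ha => by
        rw [inf_sup_left]; exact Order.Ideal.sup_mem (hx a ha) (hy a ha), le_sup_left,
        le_sup_right⟩ }
  have hZ : sSup Q ≤ Z := sSup_le fun q hq x hx a ha =>
    h q hq ⟨A.lower inf_le_left ha, q.lower inf_le_right hx⟩
  intro x hx
  have := hZ hx.2 x hx.1
  simpa using this

/-- The inverse image of an ideal under a lattice homomorphism. -/
def idealComap {K L : BddDistLat.{u}} (φ : K ⟶ L) (Z : Order.Ideal L) : Order.Ideal K :=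
  Order.IsIdeal.toIdeal (I := { x | φ x ∈ Z })
    { IsLowerSet := fun a b hba ha => Z.lower (OrderHomClass.mono φ.hom hba) ha
      Nonempty := ⟨⊥, by
        change φ.hom ⊥ ∈ Z
        rw [map_bot]
        exact Z.bot_mem⟩
      Directed := fun a ha b hb => ⟨a ⊔ b, by
        change φ.hom (a ⊔ b) ∈ Z
        rw [map_sup]
        exact Order.Ideal.sup_mem ha hb, le_sup_left, le_sup_right⟩ }

variable {D} in
/-- The ideal in `D d` generated by the values `q i`, `i ∈ I d` over `t ∈ T d`. -/
def joinIdeal {I T : C ⥤ Type u} (e : I ⟶ T) (q : I ⟶ idlFunctor D) (d : C) (t : T.obj d) :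
    Order.Ideal (D.obj d) :=
  sSup { J | ∃ i : I.obj d, e.app d i = t ∧ J = (sec q d i).ideal d le_rfl }

variable {D} in
lemma le_joinIdeal {I T : C ⥤ Type u} (e : I ⟶ T) (q : I ⟶ idlFunctor D) (d : C) (i : I.obj d) :
    (sec q d i).ideal d le_rfl ≤ joinIdeal e q d (e.app d i) :=
  le_sSup ⟨i, rfl, rfl⟩

variable {D} in
lemma joinIdeal_le {I T : C ⥤ Type u} (e : I ⟶ T) (q : I ⟶ idlFunctor D) (d : C) (t : T.obj d)
    (Z : Order.Ideal (D.obj d))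
    (h : ∀ i : I.obj d, e.app d i = t → (sec q d i).ideal d le_rfl ≤ Z) :
    joinIdeal e q d t ≤ Z := by
  refine sSup_le ?_
  rintro _ ⟨i, hi, rfl⟩
  exact h i hi

/-- The internal join of a family in the ideal completion. -/
def idlJoin {I T : C ⥤ Type u} (e : I ⟶ T) (q : I ⟶ idlFunctor D) : T ⟶ idlFunctor D where
  app c := ↾(fun t =>
    { ideal := fun d h => joinIdeal e q d (T.map (homOfLE h) t)
      map_mem := fun d d' h h' x hx => by
        change x ∈ idealComap (D.map (homOfLE h'))
          (joinIdeal e q d' (T.map (homOfLE (h.trans h')) t))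
        refine joinIdeal_le e q d _ _ ?_ hx
        intro i hi y hy
        have h1 := (sec q d i).map_mem d d' le_rfl h' y hy
        have h2 := le_joinIdeal e q d' (I.map (homOfLE h') i)
        rw [sec_map, NatTrans.naturality_apply, hi, ← Functor.map_comp_apply] at h2
        exact h2 h1 })
  naturality c c' f := by
    ext t
    refine IdealSection.ext (funext fun d => funext fun hd => ?_)
    change joinIdeal e q d (T.map (homOfLE hd) (T.map f t)) =
      joinIdeal e q d (T.map (homOfLE ((leOfHom f).trans hd)) t)
    rw [← Functor.map_comp_apply]
    rfl

lemma idlJoin_ideal {I T : C ⥤ Type u} (e : I ⟶ T) (q : I ⟶ idlFunctor D) (c : C) (t : T.obj c)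
    (d : C) (h : c ≤ d) :
    (sec (idlJoin D e q) c t).ideal d h = joinIdeal e q d (T.map (homOfLE h) t) := rfl

/-- The functor represented by `d`. -/
def representable (d : C) : C ⥤ Type u where
  obj d' := ULift.{u} (PLift (d ≤ d'))
  map f := ↾(fun r => ⟨⟨r.down.down.trans (leOfHom f)⟩⟩)
  map_id _ := rfl
  map_comp _ _ := rfl

/-- The generalized element of `F` given by an element of `F d`. -/
def representableHom {d : C} (F : C ⥤ Type u) (x : F.obj d) : representable d ⟶ F where
  app d' := ↾(fun r => F.map (homOfLE r.down.down) x)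
  naturality d' d'' f := by
    ext r
    change F.map (homOfLE _) x = F.map f (F.map (homOfLE _) x)
    rw [← Functor.map_comp_apply]
    rfl

lemma representableHom_app {d : C} (F : C ⥤ Type u) (x : F.obj d) :
    (representableHom F x).app d ⟨⟨le_rfl⟩⟩ = x := by
  change F.map (𝟙 d) x = x
  simp

lemma idlJoin_isJoin {I T : C ⥤ Type u} (e : I ⟶ T) (q : I ⟶ idlFunctor D) :
    (idlPoset D).IsJoin e q (idlJoin D e q) := by
  intro T' α y
  refine (idl_le D _ _).trans ⟨fun h T'' β i hi => (idl_le D _ _).2 ?_,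
    fun h c t d hd => joinIdeal_le e q d _ _ ?_⟩
  · intro c t d hd
    refine le_trans ?_ (h c (β.app c t) d hd)
    have h1 := le_joinIdeal e q d (I.map (homOfLE hd) (i.app c t))
    rw [sec_map, NatTrans.naturality_apply] at h1
    refine h1.trans (le_of_eq ?_)
    have h2 : e.app c (i.app c t) = α.app c (β.app c t) :=
      congrArg (fun k : T'' ⟶ T => k.app c t) hi
    rw [h2]
    rfl
  · intro i hi
    have hT : e.app d i = α.app d (T'.map (homOfLE hd) t) := by
      rw [NatTrans.naturality_apply]
      exact hi
    have h1 := (idl_le D _ _).1 (h (representableHom T' (T'.map (homOfLE hd) t))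
      (representableHom I i) (by
        ext d' r
        change e.app d' (I.map _ i) = α.app d' (T'.map _ _)
        rw [NatTrans.naturality_apply, NatTrans.naturality_apply, hT])) d ⟨⟨le_rfl⟩⟩ d le_rfl
    change (sec q d ((representableHom I i).app d ⟨⟨le_rfl⟩⟩)).ideal d le_rfl ≤
      (sec y d ((representableHom T' (T'.map (homOfLE hd) t)).app d ⟨⟨le_rfl⟩⟩)).ideal d le_rfl
      at h1
    rw [representableHom_app, representableHom_app, sec_map] at h1
    exact h1

/-- The internal top element of the ideal completion. -/
def idlTop (T : C ⥤ Type u) : T ⟶ idlFunctor D where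
  app _ := ↾(fun _ => { ideal := fun _ _ => ⊤, map_mem := fun _ _ _ _ _ _ => trivial })
  naturality _ _ _ := rfl

/-- The internal meet in the ideal completion. -/
def idlMeet {T : C ⥤ Type u} (x y : T ⟶ idlFunctor D) : T ⟶ idlFunctor D where
  app c := ↾(fun t =>
    { ideal := fun d h => (sec x c t).ideal d h ⊓ (sec y c t).ideal d h
      map_mem := fun d d' h h' z hz =>
        ⟨(sec x c t).map_mem d d' h h' z hz.1, (sec y c t).map_mem d d' h h' z hz.2⟩ })
  naturality c c' f := by
    ext t
    refine IdealSection.ext (funext fun d => funext fun hd => ?_)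
    change (sec x c' (T.map f t)).ideal d hd ⊓ (sec y c' (T.map f t)).ideal d hd = _
    rw [sec_map, sec_map]
    rfl

lemma idlMeet_isMeet {T : C ⥤ Type u} (x y : T ⟶ idlFunctor D) :
    (idlPoset D).IsMeet x y (idlMeet D x y) := by
  intro T' α z
  refine (idl_le D _ _).trans (Iff.trans ?_ (and_congr (idl_le D _ _).symm (idl_le D _ _).symm))
  constructor
  · exact fun h => ⟨fun c t d hd => (h c t d hd).trans inf_le_left,
      fun c t d hd => (h c t d hd).trans inf_le_right⟩
  · exact fun h c t d hd => le_inf (h.1 c t d hd) (h.2 c t d hd)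

/-- The internal ideal completion of an internal distributive lattice `D` in the Kripke topos
`Set^C`, as an internal frame. -/
noncomputable abbrev idl : InternalFrame (C ⥤ Type u) where
  toInternalPoset := idlPoset D
  exists_top T := ⟨idlTop D T, fun T' α z => (idl_le D _ _).2 fun c t d hd => le_top⟩
  exists_meet T x y := ⟨idlMeet D x y, idlMeet_isMeet D x y⟩
  exists_join I T e q := ⟨idlJoin D e q, idlJoin_isJoin D e q⟩
  distrib I T e q r s a m hs hm hr := by
    obtain rfl := hs.unique (idlJoin_isJoin D e q)
    obtain rfl := hm.unique (idlMeet_isMeet D _ _)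
    obtain rfl := hr.unique (idlMeet_isMeet D _ _)
    have key : idlMeet D a (idlJoin D e q) = idlJoin D e (idlMeet D (e ≫ a) q) := by
      refine sec_ext fun c t =>
        IdealSection.ext (funext fun d => funext fun hd => le_antisymm ?_ ?_)
      · refine ideal_inf_sSup_le _ _ _ ?_
        rintro _ ⟨i, hi, rfl⟩
        have h1 := le_joinIdeal e (idlMeet D (e ≫ a) q) d i
        rw [hi] at h1
        refine le_trans (le_of_eq ?_) h1
        change _ = (sec a d (e.app d i)).ideal d le_rfl ⊓ _
        rw [hi, sec_map]
        rfl
      · refine joinIdeal_le _ _ _ _ _ fun i hi => le_inf ?_ ?_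
        · refine le_trans inf_le_left (le_of_eq ?_)
          change (sec a d (e.app d i)).ideal d le_rfl = _
          rw [hi, sec_map]
          rfl
        · have h1 := le_joinIdeal e q d i
          rw [hi] at h1
          exact le_trans inf_le_right h1
    change (idlPoset D).IsJoin e (idlMeet D (e ≫ a) q) (idlMeet D a (idlJoin D e q))
    rw [key]
    exact idlJoin_isJoin D e _

end IdealCompletion

/-! ## Box presentations -/

/-- A box presentation: a map `S → I` of finite sets. -/
structure BoxPresentation where
  questions : Type u
  parties : Type u
  [finite_questions : Finite questions]
  [finite_parties : Finite parties]
  proj : questions → parties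

namespace BoxPresentation

attribute [instance] BoxPresentation.finite_questions BoxPresentation.finite_parties

/-- A commutative square of maps of finite sets, injective on each fibre `S'_{i'}`. -/
@[ext]
structure Hom (P' P : BoxPresentation.{u}) where
  onQuestions : P'.questions → P.questions
  onParties : P'.parties → P.parties
  comm : ∀ s, P.proj (onQuestions s) = onParties (P'.proj s)
  injOn_fibre : ∀ i, Set.InjOn onQuestions (P'.proj ⁻¹' {i})

/-- The category `Box` of box presentations. -/
instance : Category BoxPresentation.{u} where
  Hom := Hom
  id P := ⟨id, id, fun _ => rfl, fun _ => Function.injective_id.injOn⟩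
  comp {P Q R} f g :=
    { onQuestions := g.onQuestions ∘ f.onQuestions
      onParties := g.onParties ∘ f.onParties
      comm := fun s => by simp [g.comm, f.comm]
      injOn_fibre := fun i s hs t ht h => f.injOn_fibre i hs ht
        (g.injOn_fibre (f.onParties i)
          (show Q.proj (f.onQuestions s) = _ by rw [f.comm, show P.proj s = i from hs])
          (show Q.proj (f.onQuestions t) = _ by rw [f.comm, show P.proj t = i from ht]) h) }

variable (P : BoxPresentation.{u})

/-- A context: a set of questions on which the projection to the parties is injective. -/
def Context : Type u := { c : Set P.questions // Set.InjOn P.proj c }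

/-- Contexts are ordered by inclusion. -/
instance : PartialOrder P.Context := inferInstanceAs (PartialOrder (Subtype _))

/-- The embedding of the poset of contexts into the category of sets. -/
def tautological : P.Context ⥤ Type u where
  obj c := c.1
  map f := ↾(Set.inclusion (leOfHom f))
  map_id _ := rfl
  map_comp _ _ := rfl

end BoxPresentation

/-- The free Boolean algebra `2^(2^X)` on a finite set `X`, functorially in `X`: a map `X → Y`
sends `A ⊂ 2^X` to the set of all `v : Y → 2` whose restriction along `X → Y` is in `A`. -/
def freeBool : Type u ⥤ BoolAlg.{u} where
  obj X := BoolAlg.of (Set (X → Bool))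
  map f := BoolAlg.ofHom
    { toFun := fun A => { v | (fun x => v (f x)) ∈ A }
      map_sup' := fun _ _ => rfl
      map_inf' := fun _ _ => rfl
      map_top' := rfl
      map_bot' := rfl }
  map_id _ := rfl
  map_comp _ _ := rfl

/-- For a finite set `X`, the Boolean algebra `freeBool X` is free on the elements
`{v | v s = true}`, `s ∈ X`. -/
theorem freeBool_universal (X : Type u) [Finite X] (B : BoolAlg.{u}) (b : X → B) :
    ∃! f : freeBool.obj X ⟶ B, ∀ s : X, f (show Set (X → Bool) from { v | v s = true }) = b s := by
  classical
  have := Fintype.ofFinite X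
  let lit : X → (X → Bool) → B := fun s v => if v s = true then b s else (b s)ᶜ
  let atom : (X → Bool) → B := fun v => Finset.univ.inf fun s => lit s v
  let F : Set (X → Bool) → B := fun A => (Finset.univ.filter (· ∈ A)).sup atom
  have atom_le : ∀ v s, atom v ≤ lit s v := fun v s => Finset.inf_le (Finset.mem_univ s)
  have le_F : ∀ A v, v ∈ A → atom v ≤ F A := fun A v h =>
    Finset.le_sup (f := atom) (by simpa using h)
  have F_le : ∀ A y, (∀ v ∈ A, atom v ≤ y) → F A ≤ y := fun A y h =>
    Finset.sup_le fun v hv => h v (by simpa using hv)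
  have disj : ∀ v w, v ≠ w → atom v ⊓ atom w = ⊥ := by
    intro v w hvw
    obtain ⟨s, hs⟩ := Function.ne_iff.1 hvw
    refine le_bot_iff.1 ((inf_le_inf (atom_le v s) (atom_le w s)).trans ?_)
    simp only [lit]
    cases hv : v s <;> cases hw : w s <;> simp_all
  have cover : ∀ (t : Finset X) (y : B),
      (∀ v : X → Bool, (t.inf fun s => lit s v) ≤ y) → y = ⊤ := by
    intro t
    induction t using Finset.induction_on with
    | empty => intro y h; simpa using h (fun _ => true)
    | insert a t ha ih =>
      intro y h
      refine ih y fun v => ?_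
      have hupd : ∀ c, (t.inf fun s => lit s (Function.update v a c)) = t.inf fun s => lit s v := by
        intro c
        refine Finset.inf_congr rfl fun s hs => ?_
        have : s ≠ a := fun h => ha (h ▸ hs)
        simp [lit, Function.update_of_ne this]
      have h1 := h (Function.update v a true)
      have h2 := h (Function.update v a false)
      rw [Finset.inf_insert, hupd] at h1 h2
      simp only [lit, Function.update_self, if_true, Bool.false_eq_true, if_false] at h1 h2
      have h3 := sup_le h1 h2
      rwa [← inf_sup_right, sup_compl_eq_top, top_inf_eq] at h3
  have F_top : F Set.univ = ⊤ :=
    cover Finset.univ _ fun v => le_F _ v (Set.mem_univ v)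
  have F_inf : ∀ A A', F (A ⊓ A') = F A ⊓ F A' := by
    intro A A'
    refine le_antisymm (F_le _ _ fun v hv => le_inf (le_F _ _ hv.1) (le_F _ _ hv.2)) ?_
    change Finset.sup _ _ ⊓ Finset.sup _ _ ≤ _
    rw [Finset.sup_inf_sup]
    refine Finset.sup_le fun p hp => ?_
    simp only [Finset.mem_product, Finset.mem_filter, Finset.mem_univ, true_and] at hp
    by_cases h : p.1 = p.2
    · exact inf_le_left.trans (le_F _ _ ⟨hp.1, h ▸ hp.2⟩)
    · rw [disj _ _ h]; exact bot_le
  have F_sup : ∀ A A', F (A ⊔ A') = F A ⊔ F A' := by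
    intro A A'
    refine le_antisymm (F_le _ _ fun v hv => ?_)
      (sup_le (F_le _ _ fun v hv => le_F _ _ (Or.inl hv))
        (F_le _ _ fun v hv => le_F _ _ (Or.inr hv)))
    rcases hv with hv | hv
    · exact (le_F _ _ hv).trans le_sup_left
    · exact (le_F _ _ hv).trans le_sup_right
  have F_gen : ∀ s, F { v | v s = true } = b s := by
    intro s
    refine le_antisymm (F_le _ _ fun v hv => ?_) ?_
    · have := atom_le v s
      simpa [lit, show v s = true from hv] using this
    · have h : b s = b s ⊓ F Set.univ := by rw [F_top, inf_top_eq]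
      rw [h]
      change _ ⊓ Finset.sup _ _ ≤ _
      rw [Finset.sup_inf_distrib_left]
      refine Finset.sup_le fun v _ => ?_
      by_cases hv : v s = true
      · exact inf_le_right.trans (le_F _ _ hv)
      · refine (inf_le_inf_left _ (atom_le v s)).trans ?_
        simp [lit, hv]
  refine ⟨BoolAlg.ofHom (X := Set (X → Bool)) (Y := B)
    { toFun := F
      map_sup' := F_sup
      map_inf' := F_inf
      map_top' := F_top
      map_bot' := le_bot_iff.1 (F_le _ _ fun v hv => hv.elim) }, F_gen, ?_⟩
  intro g hg
  have key : ∀ (f f' : BoundedLatticeHom (Set (X → Bool)) B),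
      (∀ s, f { v | v s = true } = f' { v | v s = true }) → f = f' := by
    intro f f' h
    have hlit : ∀ (v : X → Bool) (s : X), f { w | w s = v s } = f' { w | w s = v s } := by
      intro v s
      cases hv : v s
      · have : { w : X → Bool | w s = false } = { w | w s = true }ᶜ := by ext w; simp
        rw [this, map_compl', map_compl', h]
      · exact h s
    have hsingle : ∀ v : X → Bool, ({v} : Set (X → Bool)) =
        Finset.univ.inf fun s => { w : X → Bool | w s = v s } := by
      intro v
      ext w
      simp [Finset.inf_set_eq_iInter, funext_iff]
    ext A
    have hA : A = (Finset.univ.filter (· ∈ A)).sup fun v => ({v} : Set (X → Bool)) := by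
      ext w
      simp [Finset.sup_set_eq_biUnion]
    rw [hA, map_finset_sup, map_finset_sup]
    refine Finset.sup_congr rfl fun v _ => ?_
    simp only [Function.comp, hsingle, map_finset_inf]
    exact Finset.inf_congr rfl fun s _ => hlit v s
  refine BoolAlg.hom_ext (key g.hom _ fun s => (hg s).trans (F_gen s).symm)

namespace BoxPresentation

variable (P : BoxPresentation.{u})

/-- The internal Boolean algebra `L_{S/I}` of measurement logics. -/
def logic : P.Context ⥤ BoolAlg.{u} := P.tautological ⋙ freeBool

/-- `L_{S/I}` as an internal distributive lattice. -/
def latticeLogic : P.Context ⥤ BddDistLat.{u} := P.logic ⋙ forget₂ BoolAlg BddDistLat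

/-- The internal frame `F_{S/I} = Idl L_{S/I}` in `Set^{C_{S/I}}`. -/
noncomputable def frame : InternalFrame (P.Context ⥤ Type u) := idl P.latticeLogic

/-- The framed topos `(Set^{C_{S/I}}, F_{S/I})`. -/
noncomputable def framedTopos : FramedTopos.{u, u + 1} where
  topos := P.Context ⥤ Type u
  frame := P.frame

variable {P}

/-- The isotone map `C_{S/I} → C_{S'/I'}` induced by a morphism `S'/I' → S/I`: inverse image. -/
def contextMap {P' : BoxPresentation.{u}} (f : P' ⟶ P) : P.Context →o P'.Context where
  toFun c := ⟨Hom.onQuestions f ⁻¹' c.1, fun s hs t ht h =>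
    Hom.injOn_fibre f (P'.proj t) h rfl
      (c.2 hs ht (by rw [Hom.comm f, Hom.comm f, h]))⟩
  monotone' _ _ h := Set.preimage_mono h

/-- The natural map `φ⁻¹(c) → c` for a context `c` of `S/I`. -/
def contextHom {P' : BoxPresentation.{u}} (f : P' ⟶ P) (c : P.Context) :
    P'.tautological.obj (contextMap f c) ⟶ P.tautological.obj c :=
  ↾(fun s => ⟨Hom.onQuestions f s.1, s.2⟩)

/-- The Boolean algebra homomorphism `L_{S'/I'}(φ⁻¹ c) → L_{S/I}(c)`, a component of
`φ^* L_{S'/I'} ⟶ L_{S/I}`. -/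
def logicHom {P' : BoxPresentation.{u}} (f : P' ⟶ P) (c : P.Context) :
    P'.logic.obj (contextMap f c) ⟶ P.logic.obj c :=
  freeBool.map (contextHom f c)

end BoxPresentation

/-!
A geometric morphism `φ : Set^C → Set^C'` induced by an isotone map has precomposition with `φ` as
inverse image, so the functor from box presentations to framed topoi amounts to homomorphisms of
internal frames `Idl L' ⟶ φ_* Idl L` which are compatible with composition.

Order, meets and joins of an internal frame in `Set^C` can be tested on elements at the stages
`c : C` (`InternalPoset.le_iff_leAt`, `InternalPoset.isJoin_iff_leAt`). With this, the ideal
completion `Idl D` is the free internal frame on the internal distributive lattice `D`: every ideal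
is the internal join of the principal ideals of its members (`isJoin_principalHom`), so a frame
homomorphism on `Idl D` is determined by its restriction to `D`; conversely a lattice homomorphism
`k : D ⟶ H` extends to `J ↦ ⋁ {k x | x ∈ J}`, which preserves joins because it has the right adjoint
`y ↦ {x | k x ≤ y}`, and finite meets by distributivity in `H` (`idlLift`).

A frame homomorphism `Idl D ⟶ φ_* H` restricts to a lattice homomorphism `D ⟶ φ_* H`, whose
transpose `φ^* D ⟶ H` is again a lattice homomorphism. Hence `Idl (φ^* D)` has the universal
property of `φ^♯ (Idl D)` (`idlUnit_isSharp`), and the homomorphism `φ^* L' ⟶ L` of measurement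
logics induces `φ^♯ (Idl L') ≅ Idl (φ^* L') ⟶ Idl L`. Its transpose sends an ideal section `J` at
`φ c` to the ideal section `d ↦ {y | ∃ x ∈ J (φ d), y ≤ a x}`, with `a` the homomorphism of logics
at `d` (`mem_idlPushAt`). From this formula the values at principal ideals and functoriality are
read off; the right Kan extensions `φ_*` respect composition only up to the isomorphism conjugate
to the equality of inverse images, which is what the morphisms of framed topoi allow.
-/

/-! ### Generalized elements at a stage -/

section Stages

variable {C : Type u} [PartialOrder C]

lemma representableHom_comp {c : C} {F G : C ⥤ Type u} (x : F.obj c) (a : F ⟶ G) :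
    representableHom F x ≫ a = representableHom G (a.app c x) := by
  ext d r
  exact NatTrans.naturality_apply a (homOfLE r.down.down) x

lemma representableHom_map {c d : C} (h : c ≤ d) (F : C ⥤ Type u) (x : F.obj c) :
    representableHom (representable c) ⟨⟨h⟩⟩ ≫ representableHom F x =
      representableHom F (F.map (homOfLE h) x) :=
  representableHom_comp _ _

/-- A morphism of `Set^C` factors through a subobject as soon as it does so at every element,
since the factorizations are unique and therefore natural. -/
lemma subobject_factors_iff_forall {F T : C ⥤ Type u} (S : Subobject F) (f : T ⟶ F) :
    S.Factors f ↔ ∀ (c : C) (t : T.obj c), S.Factors (representableHom T t ≫ f) := by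
  refine ⟨fun h c t => Subobject.factors_of_factors_right _ h, fun h => ?_⟩
  let g : ∀ c (t : T.obj c), (S : C ⥤ Type u).obj c := fun c t =>
    (S.factorThru _ (h c t)).app c ⟨⟨le_rfl⟩⟩
  have hg : ∀ c t, S.arrow.app c (g c t) = f.app c t := by
    intro c t
    have h1 := congrArg (fun k : representable c ⟶ F => k.app c ⟨⟨le_rfl⟩⟩)
      (S.factorThru_arrow _ (h c t))
    refine h1.trans ?_
    change f.app c ((representableHom T t).app c ⟨⟨le_rfl⟩⟩) = _
    rw [representableHom_app]
  have inj : ∀ c, Function.Injective (S.arrow.app c) := fun c =>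
    (mono_iff_injective _).1 inferInstance
  let g' : T ⟶ (S : C ⥤ Type u) :=
    { app := fun c => ↾(g c)
      naturality := fun c d k => by
        ext t
        refine inj d ?_
        change S.arrow.app d (g d (T.map k t)) = S.arrow.app d ((S : C ⥤ Type u).map k (g c t))
        rw [hg, NatTrans.naturality_apply, NatTrans.naturality_apply, hg] }
  have hf : f = g' ≫ S.arrow := by
    ext c t
    exact (hg c t).symm
  rw [hf]
  exact Subobject.factors_comp_arrow _

namespace InternalPoset

/-- The order of a partially ordered object of `Set^C` on its set of elements at stage `c`. -/
def leAt (X : InternalPoset (C ⥤ Type u)) (c : C) (x y : X.carrier.obj c) : Prop :=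
  X.le (representableHom X.carrier x) (representableHom X.carrier y)

variable {X : InternalPoset (C ⥤ Type u)}

lemma le_iff_leAt {T : C ⥤ Type u} (x y : T ⟶ X.carrier) :
    X.le x y ↔ ∀ (c : C) (t : T.obj c), X.leAt c (x.app c t) (y.app c t) := by
  refine (subobject_factors_iff_forall X.rel _).trans ?_
  refine forall_congr' fun c => forall_congr' fun t => ?_
  rw [prod.comp_lift, representableHom_comp, representableHom_comp]
  rfl

lemma leAt_refl {c : C} (x : X.carrier.obj c) : X.leAt c x x := le_refl _

lemma leAt_trans {c : C} {x y z : X.carrier.obj c} (h : X.leAt c x y) (h' : X.leAt c y z) :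
    X.leAt c x z := le_trans h h'

lemma leAt_antisymm {c : C} {x y : X.carrier.obj c} (h : X.leAt c x y) (h' : X.leAt c y x) :
    x = y := by
  have h1 := congrArg (fun k : representable c ⟶ X.carrier => k.app c ⟨⟨le_rfl⟩⟩)
    (le_antisymm h h')
  simpa only [representableHom_app] using h1

lemma leAt_map {c d : C} (h : c ≤ d) {x y : X.carrier.obj c} (hxy : X.leAt c x y) :
    X.leAt d (X.carrier.map (homOfLE h) x) (X.carrier.map (homOfLE h) y) := by
  have := le_precomp (representableHom (representable c) ⟨⟨h⟩⟩) hxy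
  rwa [representableHom_map, representableHom_map] at this

lemma isTop_iff_leAt {T : C ⥤ Type u} {t : T ⟶ X.carrier} :
    X.IsTop t ↔ ∀ (c : C) (τ : T.obj c) (z : X.carrier.obj c), X.leAt c z (t.app c τ) := by
  refine ⟨fun h c τ z => ?_, fun h T' α z => (le_iff_leAt _ _).2 fun c τ => h c _ _⟩
  have := h (representableHom T τ) (representableHom X.carrier z)
  rwa [representableHom_comp] at this

lemma isMeet_iff_leAt {T : C ⥤ Type u} {x y m : T ⟶ X.carrier} :
    X.IsMeet x y m ↔ ∀ (c : C) (τ : T.obj c) (z : X.carrier.obj c),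
      X.leAt c z (m.app c τ) ↔ X.leAt c z (x.app c τ) ∧ X.leAt c z (y.app c τ) := by
  refine ⟨fun h c τ z => ?_, fun h T' α z => ?_⟩
  · have := h (representableHom T τ) (representableHom X.carrier z)
    rwa [representableHom_comp, representableHom_comp, representableHom_comp] at this
  · simp only [le_iff_leAt, ← forall_and]
    exact forall_congr' fun c => forall_congr' fun τ => h c _ _

lemma isJoin_iff_leAt {I T : C ⥤ Type u} {e : I ⟶ T} {q : I ⟶ X.carrier} {s : T ⟶ X.carrier} :
    X.IsJoin e q s ↔ ∀ (c : C) (τ : T.obj c) (y : X.carrier.obj c),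
      X.leAt c (s.app c τ) y ↔ ∀ (d : C) (h : c ≤ d) (i : I.obj d),
        e.app d i = T.map (homOfLE h) τ →
          X.leAt d (q.app d i) (X.carrier.map (homOfLE h) y) := by
  constructor
  · intro H c τ y
    have h1 := H (representableHom T τ) (representableHom X.carrier y)
    rw [representableHom_comp] at h1
    refine h1.trans ⟨fun h2 d h i hi => ?_, fun h2 T'' β i hi => (le_iff_leAt _ _).2 fun d t => ?_⟩
    · have h3 := h2 (representableHom (representable c) ⟨⟨h⟩⟩) (representableHom I i)
        (by rw [representableHom_comp, representableHom_map, hi])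
      rwa [representableHom_comp, representableHom_map] at h3
    · exact h2 d (β.app d t).down.down (i.app d t)
        (congrArg (fun k : T'' ⟶ T => k.app d t) hi)
  · intro H T' α y
    rw [le_iff_leAt]
    constructor
    · intro h2 T'' β i hi
      refine (le_iff_leAt _ _).2 fun d t => ?_
      have h3 := (H d (α.app d (β.app d t)) (y.app d (β.app d t))).1 (h2 d (β.app d t)) d le_rfl
        (i.app d t) ((congrArg (fun k : T'' ⟶ T => k.app d t) hi).trans
          (Functor.map_id_apply T _ _).symm)
      exact (Functor.map_id_apply X.carrier d (y.app d (β.app d t))) ▸ h3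
    · intro h2 c t
      refine (H c _ _).2 fun d h i hi => ?_
      have h3 := (le_iff_leAt _ _).1 (h2 (representableHom T' (T'.map (homOfLE h) t))
        (representableHom I i) (by
          rw [representableHom_comp, representableHom_comp, hi, NatTrans.naturality_apply]
          rfl)) d ⟨⟨le_rfl⟩⟩
      rw [representableHom_comp, representableHom_comp, representableHom_app,
        representableHom_app, NatTrans.naturality_apply] at h3
      exact h3

end InternalPoset

end Stages

namespace InternalFrame

section

variable {E : Type u} [Category.{v} E] [HasFiniteLimits E] {H : InternalFrame E}

/-- Distributivity in the form of an elimination rule: an element below `a` and below a join is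
below `y` if at all later stages every element below `a` and below a member of the family is. -/
lemma le_of_le_of_le_join {I T T' : E} {e : I ⟶ T} {q : I ⟶ H.carrier} {s : T ⟶ H.carrier}
    (hs : H.IsJoin e q s) (α : T' ⟶ T) {a y z : T' ⟶ H.carrier} (hza : H.le z a)
    (hzs : H.le z (α ≫ s))
    (h : ∀ ⦃T'' : E⦄ (β : T'' ⟶ T') (i : T'' ⟶ I) (w : T'' ⟶ H.carrier), i ≫ e = β ≫ α →
      H.le w (β ≫ a) → H.le w (i ≫ q) → H.le w (β ≫ y)) : H.le z y := by
  have hs' : H.IsJoin (pullback.snd e α) (pullback.fst e α ≫ q) (α ≫ s) := by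
    intro S γ x
    rw [← Category.assoc]
    refine (hs (γ ≫ α) x).trans ⟨fun h S' β i hi => ?_, fun h S' β i hi => ?_⟩
    · rw [← Category.assoc]
      exact h β _ (by rw [Category.assoc, pullback.condition, ← Category.assoc, hi,
        Category.assoc])
    · have := h β (pullback.lift i (β ≫ γ) (by rw [hi, Category.assoc])) (pullback.lift_snd _ _ _)
      rwa [← Category.assoc, pullback.lift_fst] at this
  obtain ⟨m, hm⟩ := H.exists_meet a (α ≫ s)
  obtain ⟨r, hr⟩ := H.exists_meet (pullback.snd e α ≫ a) (pullback.fst e α ≫ q)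
  have hj := H.distrib _ _ _ _ _ _ hs' hm hr
  have hzm : H.le z m := by simpa using (hm (𝟙 _) z).2 (by simpa using ⟨hza, hzs⟩)
  refine InternalPoset.le_trans hzm ?_
  have hmy := (hj (𝟙 _) y).2 ?_
  · simpa using hmy
  intro S β i hi
  rw [Category.comp_id] at hi
  have h1 := (hr i (i ≫ r)).1 (InternalPoset.le_refl _)
  rw [← Category.assoc, ← Category.assoc, hi] at h1
  exact h β (i ≫ pullback.fst e α) _
    (by rw [Category.assoc, pullback.condition, ← Category.assoc, hi]) h1.1 h1.2

end

variable {C : Type u} [PartialOrder C] {H : InternalFrame (C ⥤ Type u)}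

/-- The elimination rule `le_of_le_of_le_join` for elements at a stage. -/
lemma leAt_of_le_of_le_join {I T : C ⥤ Type u} {e : I ⟶ T} {q : I ⟶ H.carrier}
    {s : T ⟶ H.carrier} (hs : H.IsJoin e q s) {c : C} (τ : T.obj c) {a y z : H.carrier.obj c}
    (hza : H.leAt c z a) (hzs : H.leAt c z (s.app c τ))
    (h : ∀ (d : C) (hd : c ≤ d) (i : I.obj d) (w : H.carrier.obj d),
      e.app d i = T.map (homOfLE hd) τ → H.leAt d w (H.carrier.map (homOfLE hd) a) →
        H.leAt d w (q.app d i) → H.leAt d w (H.carrier.map (homOfLE hd) y)) :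
    H.leAt c z y := by
  refine le_of_le_of_le_join hs (representableHom T τ) hza
    (by rw [representableHom_comp]; exact hzs) fun T'' β i w hi hwa hwq => ?_
  rw [InternalPoset.le_iff_leAt] at hwa hwq ⊢
  exact fun d t => h d (β.app d t).down.down (i.app d t) (w.app d t)
    (congrArg (fun k : T'' ⟶ T => k.app d t) hi) (hwa d t) (hwq d t)

end InternalFrame

/-! ### The universal property of the ideal completion -/

section IdealLift

variable {C : Type u} [PartialOrder C] (D : C ⥤ BddDistLat.{u})

/-- The underlying object of an internal distributive lattice in `Set^C`. -/
def latticeElems : C ⥤ Type u where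
  obj c := D.obj c
  map f := ↾(fun x => D.map f x)
  map_id c := by ext x; simp
  map_comp f g := by ext x; simp

/-- The embedding `x ↦ ↓x` of an internal distributive lattice in its ideal completion. -/
def principalHom : latticeElems D ⟶ idlFunctor D where
  app c := ↾(IdealSection.principal D c)
  naturality c c' f := by
    ext x
    refine IdealSection.ext (funext fun d => funext fun hd => ?_)
    exact congrArg Order.Ideal.principal (Functor.map_comp_apply D f (homOfLE hd) x).symm

/-- The membership relation between ideals and elements of the lattice. -/
def idlMem : C ⥤ Type u where
  obj c := { p : IdealSection D c × D.obj c // p.2 ∈ p.1.ideal c le_rfl }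
  map {c d} f := ↾(fun p => ⟨(p.1.1.restrict (leOfHom f), D.map f p.1.2),
    p.1.1.map_mem c d le_rfl (leOfHom f) _ p.2⟩)
  map_id c := by
    ext p
    · rfl
    · exact Functor.map_id_apply D c p.1.2
  map_comp f g := by
    ext p
    · rfl
    · exact Functor.map_comp_apply D f g p.1.2

/-- The ideal of a pair in the membership relation. -/
def idlMemFst : idlMem D ⟶ idlFunctor D where
  app _ := ↾(fun p => p.1.1)
  naturality _ _ _ := rfl

/-- The lattice element of a pair in the membership relation. -/
def idlMemSnd : idlMem D ⟶ latticeElems D where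
  app _ := ↾(fun p => p.1.2)
  naturality _ _ _ := rfl

variable {D}

lemma idl_leAt {c : C} (J K : IdealSection D c) :
    (idlPoset D).leAt c J K ↔ J ≤ K := by
  refine (idl_le D _ _).trans ⟨fun h => ?_, fun h d r d' hd => h d' _⟩
  have := h c ⟨⟨le_rfl⟩⟩
  exact this

lemma mem_principal_ideal {c : C} (x : D.obj c) {d : C} (h : c ≤ d) (y : D.obj d) :
    y ∈ (IdealSection.principal D c x).ideal d h ↔ y ≤ D.map (homOfLE h) x :=
  Order.Ideal.mem_principal

lemma principal_le_iff {c : C} (x : D.obj c) (K : IdealSection D c) :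
    IdealSection.principal D c x ≤ K ↔ x ∈ K.ideal c le_rfl := by
  refine ⟨fun h => h c le_rfl ((mem_principal_ideal x le_rfl x).2 ?_), fun h d hd y hy => ?_⟩
  · exact le_of_eq (Functor.map_id_apply D c x).symm
  · exact (K.ideal d hd).lower ((mem_principal_ideal x hd y).1 hy)
      (K.map_mem c d le_rfl hd x h)

/-- Every element of the ideal completion is the internal join of the principal ideals of its
members. -/
lemma isJoin_principalHom :
    (idlPoset D).IsJoin (idlMemFst D) (idlMemSnd D ≫ principalHom D) (𝟙 (idlFunctor D)) := by
  refine InternalPoset.isJoin_iff_leAt.2 fun c J K => (idl_leAt _ _).trans ⟨?_, ?_⟩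
  · rintro h d hd p hp
    refine (idl_leAt _ _).2 ((principal_le_iff _ _).2 ?_)
    have h1 := p.2
    rw [show p.1.1 = IdealSection.restrict hd J from hp] at h1
    exact h d hd h1
  · intro h d hd x hx
    exact (principal_le_iff _ _).1 ((idl_leAt _ _).1
      (h d hd ⟨(IdealSection.restrict hd J, x), hx⟩ rfl))

/-- Homomorphisms from an ideal completion are determined by their values on principal ideals. -/
lemma idl_hom_ext {H : InternalFrame (C ⥤ Type u)} {f g : idl D ⟶ H}
    (h : principalHom D ≫ InternalFrame.Hom.hom f = principalHom D ≫ InternalFrame.Hom.hom g) :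
    f = g := by
  refine InternalFrame.hom_ext ?_
  have hf := f.map_join _ _ _ isJoin_principalHom
  have hg := g.map_join _ _ _ isJoin_principalHom
  rw [Category.assoc, h, ← Category.assoc] at hf
  simpa using hf.unique hg

/-- A morphism from an internal distributive lattice to an internal poset which is, at every
stage, a homomorphism of bounded lattices: the images of `⊤`, `⊥`, `x ⊓ y` and `x ⊔ y` have the
universal properties of the corresponding bounds. -/
structure IsLatticeHom (X : InternalPoset (C ⥤ Type u)) (k : latticeElems D ⟶ X.carrier) :
    Prop where
  le_top : ∀ (c : C) (z : X.carrier.obj c), X.leAt c z (k.app c (⊤ : D.obj c))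
  bot_le : ∀ (c : C) (z : X.carrier.obj c), X.leAt c (k.app c (⊥ : D.obj c)) z
  le_inf_iff : ∀ (c : C) (x y : D.obj c) (z : X.carrier.obj c),
    X.leAt c z (k.app c (x ⊓ y : D.obj c)) ↔ X.leAt c z (k.app c x) ∧ X.leAt c z (k.app c y)
  sup_le_iff : ∀ (c : C) (x y : D.obj c) (z : X.carrier.obj c),
    X.leAt c (k.app c (x ⊔ y : D.obj c)) z ↔ X.leAt c (k.app c x) z ∧ X.leAt c (k.app c y) z

namespace IsLatticeHom

variable {X : InternalPoset (C ⥤ Type u)} {k : latticeElems D ⟶ X.carrier}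

lemma mono (hk : IsLatticeHom X k) {c : C} {x y : D.obj c} (h : x ≤ y) :
    X.leAt c (k.app c x) (k.app c y) := by
  have h1 := ((hk.le_inf_iff c x y (k.app c x)).1 (by
    rw [inf_eq_left.2 h]; exact InternalPoset.leAt_refl _)).2
  exact h1

lemma app_map (k : latticeElems D ⟶ X.carrier) {c d : C} (h : c ≤ d) (x : D.obj c) :
    k.app d (D.map (homOfLE h) x) = X.carrier.map (homOfLE h) (k.app c x) :=
  NatTrans.naturality_apply k (homOfLE h) x

/-- The ideal `{x | k x ≤ y}` of an element `y`: the right adjoint of the extension of `k` to the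
ideal completion. -/
def preimage (hk : IsLatticeHom X k) (c : C) (y : X.carrier.obj c) : IdealSection D c where
  ideal d h := Order.IsIdeal.toIdeal
    (I := { x : D.obj d | X.leAt d (k.app d x) (X.carrier.map (homOfLE h) y) })
    { IsLowerSet := fun _ _ hba ha => InternalPoset.leAt_trans (hk.mono hba) ha
      Nonempty := ⟨⊥, hk.bot_le d _⟩
      Directed := fun a ha b hb =>
        ⟨a ⊔ b, (hk.sup_le_iff d a b _).2 ⟨ha, hb⟩, le_sup_left, le_sup_right⟩ }
  map_mem d d' h h' x hx := by
    have h1 := InternalPoset.leAt_map h' (show X.leAt d _ _ from hx)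
    rw [← app_map, ← Functor.map_comp_apply] at h1
    exact h1

lemma mem_preimage (hk : IsLatticeHom X k) {c : C} (y : X.carrier.obj c) {d : C} (h : c ≤ d)
    (x : D.obj d) : x ∈ (hk.preimage c y).ideal d h ↔
      X.leAt d (k.app d x) (X.carrier.map (homOfLE h) y) := Iff.rfl

lemma preimage_map (hk : IsLatticeHom X k) {c d : C} (h : c ≤ d) (y : X.carrier.obj c) :
    hk.preimage d (X.carrier.map (homOfLE h) y) = (hk.preimage c y).restrict h := by
  refine IdealSection.ext (funext fun d' => funext fun hd => SetLike.ext fun x => ?_)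
  rw [mem_preimage, ← Functor.map_comp_apply]
  rfl

end IsLatticeHom

section

variable {H : InternalFrame (C ⥤ Type u)} {k : latticeElems D ⟶ H.carrier}

variable (k) in
/-- The morphism of carriers underlying the extension of `k` to the ideal completion:
`J ↦ ⋁ {k x | x ∈ J}`. -/
noncomputable def idlLiftHom : idlFunctor D ⟶ H.carrier :=
  (H.exists_join (idlMemFst D) (idlMemSnd D ≫ k)).choose

variable (k) in
lemma idlLiftHom_isJoin : H.IsJoin (idlMemFst D) (idlMemSnd D ≫ k) (idlLiftHom k) :=
  (H.exists_join (idlMemFst D) (idlMemSnd D ≫ k)).choose_spec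

lemma idlLiftHom_map {c d : C} (h : c ≤ d) (J : IdealSection D c) :
    (idlLiftHom k).app d (J.restrict h) = H.carrier.map (homOfLE h) ((idlLiftHom k).app c J) :=
  NatTrans.naturality_apply (idlLiftHom k) (homOfLE h) J

lemma idlLiftHom_le_iff (hk : IsLatticeHom H.toInternalPoset k) {c : C} (J : IdealSection D c)
    (y : H.carrier.obj c) : H.leAt c ((idlLiftHom k).app c J) y ↔ J ≤ hk.preimage c y := by
  refine (InternalPoset.isJoin_iff_leAt.1 (idlLiftHom_isJoin k) c J y).trans ⟨?_, ?_⟩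
  · exact fun h d hd x hx => h d hd ⟨(IdealSection.restrict hd J, x), hx⟩ rfl
  · intro h d hd p hp
    have h1 := p.2
    rw [show p.1.1 = IdealSection.restrict hd J from hp] at h1
    exact h d hd h1

lemma le_idlLiftHom {c : C} (J : IdealSection D c) {x : D.obj c} (hx : x ∈ J.ideal c le_rfl) :
    H.leAt c (k.app c x) ((idlLiftHom k).app c J) := by
  have h1 := (InternalPoset.isJoin_iff_leAt.1 (idlLiftHom_isJoin k) c J _).1
    (InternalPoset.leAt_refl _) c le_rfl ⟨(J, x), hx⟩ rfl
  rwa [show H.carrier.map (homOfLE (le_refl c)) ((idlLiftHom k).app c J) = _ from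
    Functor.map_id_apply H.carrier c _] at h1

lemma idlLiftHom_mono (hk : IsLatticeHom H.toInternalPoset k) {c : C} {J K : IdealSection D c}
    (h : J ≤ K) : H.leAt c ((idlLiftHom k).app c J) ((idlLiftHom k).app c K) :=
  (idlLiftHom_le_iff hk _ _).2 (h.trans ((idlLiftHom_le_iff hk _ _).1 (InternalPoset.leAt_refl _)))

lemma idlLiftHom_principal (hk : IsLatticeHom H.toInternalPoset k) (c : C) (x : D.obj c) :
    (idlLiftHom k).app c (IdealSection.principal D c x) = k.app c x := by
  refine InternalPoset.leAt_antisymm ((idlLiftHom_le_iff hk _ _).2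
    ((principal_le_iff _ _).2 ?_)) (le_idlLiftHom _ ((principal_le_iff _ _).1 le_rfl))
  rw [IsLatticeHom.mem_preimage, show H.carrier.map (homOfLE (le_refl c)) (k.app c x) = _ from
    Functor.map_id_apply H.carrier c _]
  exact InternalPoset.leAt_refl _

/-- The extension of an internal lattice homomorphism preserves binary meets: an element below
`⋁ {k x | x ∈ J}` and `⋁ {k y | y ∈ K}` is, by distributivity, below
`⋁ {k x ⊓ k y | x ∈ J, y ∈ K}`, and `k x ⊓ k y = k (x ⊓ y)` with `x ⊓ y ∈ J ⊓ K`. -/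
lemma le_idlLiftHom_of_le_of_le (hk : IsLatticeHom H.toInternalPoset k) {c : C}
    {J K M : IdealSection D c} (hM : ∀ d h, J.ideal d h ⊓ K.ideal d h ≤ M.ideal d h)
    {z : H.carrier.obj c} (hJ : H.leAt c z ((idlLiftHom k).app c J))
    (hK : H.leAt c z ((idlLiftHom k).app c K)) : H.leAt c z ((idlLiftHom k).app c M) := by
  refine InternalFrame.leAt_of_le_of_le_join (idlLiftHom_isJoin k) J hK hJ
    fun d hd p w hp hwK hwp => ?_
  rw [← idlLiftHom_map] at hwK ⊢
  refine InternalFrame.leAt_of_le_of_le_join (idlLiftHom_isJoin k) (K.restrict hd) hwp hwK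
    fun d' hd' p' w' hp' hwp' hwp'' => ?_
  rw [← idlLiftHom_map]
  have hx := p.1.1.map_mem d d' le_rfl hd' _ p.2
  have hy := p'.2
  rw [show p.1.1 = IdealSection.restrict hd J from hp] at hx
  rw [show p'.1.1 = IdealSection.restrict hd' (K.restrict hd) from hp'] at hy
  refine InternalPoset.leAt_trans ((hk.le_inf_iff d' (D.map (homOfLE hd') p.1.2) p'.1.2 w').2
    ⟨?_, hwp''⟩) (le_idlLiftHom _ (hM d' _
      ⟨(J.ideal d' _).lower inf_le_left hx, (K.ideal d' _).lower inf_le_right hy⟩))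
  rw [IsLatticeHom.app_map]
  exact hwp'

/-- The extension of an internal lattice homomorphism `k : D ⟶ H` to a homomorphism of internal
frames `Idl D ⟶ H`. -/
noncomputable def idlLift (hk : IsLatticeHom H.toInternalPoset k) : idl D ⟶ H where
  hom := idlLiftHom k
  map_top T t ht := by
    refine InternalPoset.isTop_iff_leAt.2 fun c τ z =>
      InternalPoset.leAt_trans (hk.le_top c z) (le_idlLiftHom _ ?_)
    exact (principal_le_iff _ _).1 ((idl_leAt _ _).1 (InternalPoset.isTop_iff_leAt.1 ht c τ _))
  map_meet T x y m hm := by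
    obtain rfl := hm.unique (idlMeet_isMeet D x y)
    refine InternalPoset.isMeet_iff_leAt.2 fun c τ z => ⟨fun h => ⟨?_, ?_⟩, fun h => ?_⟩
    · exact InternalPoset.leAt_trans h (idlLiftHom_mono hk fun d hd => inf_le_left)
    · exact InternalPoset.leAt_trans h (idlLiftHom_mono hk fun d hd => inf_le_right)
    · exact le_idlLiftHom_of_le_of_le hk (fun d hd => le_rfl) h.1 h.2
  map_join I T e q s hs := by
    refine InternalPoset.isJoin_iff_leAt.2 fun c τ y => (idlLiftHom_le_iff hk _ _).trans ?_
    refine (idl_leAt _ _).symm.trans ((InternalPoset.isJoin_iff_leAt.1 hs c τ _).trans ?_)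
    refine forall_congr' fun d => forall_congr' fun hd => forall_congr' fun i =>
      forall_congr' fun _ => ?_
    refine (idl_leAt _ _).trans (Iff.trans ?_ (idlLiftHom_le_iff hk _ _).symm)
    rw [hk.preimage_map]
    rfl

lemma principalHom_idlLift (hk : IsLatticeHom H.toInternalPoset k) :
    principalHom D ≫ InternalFrame.Hom.hom (idlLift hk) = k := by
  ext c x
  exact idlLiftHom_principal hk c x

end

end IdealLift

/-! ### Internal lattice homomorphisms -/

section Pairs

variable {C : Type u} [PartialOrder C]

/-- The object of pairs of elements of an internal lattice. The lattice operations are morphisms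
from it, also `⊤` and `⊥`, which are taken as constant binary operations. -/
def latticePairs (D : C ⥤ BddDistLat.{u}) : C ⥤ Type u where
  obj c := D.obj c × D.obj c
  map f := ↾(fun p => (D.map f p.1, D.map f p.2))
  map_id c := by ext p <;> simp
  map_comp f g := by ext p <;> simp

/-- A natural binary operation on an internal lattice. -/
def latticePairsHom {D : C ⥤ BddDistLat.{u}} (o : ∀ c, D.obj c → D.obj c → D.obj c)
    (ho : ∀ ⦃c d⦄ (f : c ⟶ d) x y, D.map f (o c x y) = o d (D.map f x) (D.map f y)) :
    latticePairs D ⟶ latticeElems D where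
  app c := ↾(fun p => o c p.1 p.2)
  naturality c d f := by
    ext p
    exact (ho f p.1 p.2).symm

/-- The first projection `D × D ⟶ D`. -/
abbrev latticeFst (D : C ⥤ BddDistLat.{u}) : latticePairs D ⟶ latticeElems D :=
  latticePairsHom (fun _ x _ => x) fun _ _ _ _ _ => rfl

/-- The second projection `D × D ⟶ D`. -/
abbrev latticeSnd (D : C ⥤ BddDistLat.{u}) : latticePairs D ⟶ latticeElems D :=
  latticePairsHom (fun _ _ y => y) fun _ _ _ _ _ => rfl

/-- The constant operation `⊤`, as an operation on pairs. -/
abbrev latticeTop (D : C ⥤ BddDistLat.{u}) : latticePairs D ⟶ latticeElems D :=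
  latticePairsHom (fun _ _ _ => ⊤) fun _ _ f _ _ => map_top (D.map f).hom

/-- The constant operation `⊥`, as an operation on pairs. -/
abbrev latticeBot (D : C ⥤ BddDistLat.{u}) : latticePairs D ⟶ latticeElems D :=
  latticePairsHom (fun _ _ _ => ⊥) fun _ _ f _ _ => map_bot (D.map f).hom

/-- The meet operation `D × D ⟶ D`. -/
abbrev latticeInf (D : C ⥤ BddDistLat.{u}) : latticePairs D ⟶ latticeElems D :=
  latticePairsHom (fun _ x y => x ⊓ y) fun _ _ f x y => map_inf (D.map f).hom x y

/-- The join operation `D × D ⟶ D`. -/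
abbrev latticeSup (D : C ⥤ BddDistLat.{u}) : latticePairs D ⟶ latticeElems D :=
  latticePairsHom (fun _ x y => x ⊔ y) fun _ _ f x y => map_sup (D.map f).hom x y

/-- The two members of a pair, as an internal family parametrized by the object of pairs. -/
def latticeMembers (D : C ⥤ BddDistLat.{u}) : C ⥤ Type u where
  obj c := (D.obj c × D.obj c) × Bool
  map f := ↾(fun p => ((D.map f p.1.1, D.map f p.1.2), p.2))
  map_id c := by ext p <;> simp
  map_comp f g := by ext p <;> simp

/-- The projection of the members of pairs to the object of pairs. -/
def latticeMembersProj (D : C ⥤ BddDistLat.{u}) : latticeMembers D ⟶ latticePairs D where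
  app _ := ↾(fun p => p.1)
  naturality _ _ _ := rfl

/-- The value of a member of a pair. -/
def latticeMembersVal (D : C ⥤ BddDistLat.{u}) : latticeMembers D ⟶ latticeElems D where
  app _ := ↾(fun p => cond p.2 p.1.1 p.1.2)
  naturality c d f := by
    ext ⟨p, b⟩
    cases b <;> rfl

/-- The morphism from the empty functor: the empty internal family. -/
def emptyHom (T : C ⥤ Type u) : (Functor.const C).obj PEmpty.{u + 1} ⟶ T where
  app _ := ↾PEmpty.elim
  naturality _ _ _ := by
    ext x
    exact x.elim

variable {D : C ⥤ BddDistLat.{u}}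

/-- The stagewise notion of an internal lattice homomorphism agrees with the one expressed by
internal meets and joins. The latter is transported by geometric morphisms. -/
lemma isLatticeHom_iff {X : InternalPoset (C ⥤ Type u)} {k : latticeElems D ⟶ X.carrier} :
    IsLatticeHom X k ↔ X.IsTop (latticeTop D ≫ k) ∧
      X.IsMeet (latticeFst D ≫ k) (latticeSnd D ≫ k) (latticeInf D ≫ k) ∧
      X.IsJoin (emptyHom (latticePairs D)) (emptyHom X.carrier) (latticeBot D ≫ k) ∧
      X.IsJoin (latticeMembersProj D) (latticeMembersVal D ≫ k) (latticeSup D ≫ k) := by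
  have key : ∀ (c : C) (x y : D.obj c) (z : X.carrier.obj c),
      (∀ (d : C) (h : c ≤ d) (i : (latticeMembers D).obj d),
        (latticeMembersProj D).app d i = (latticePairs D).map (homOfLE h) (x, y) →
          X.leAt d ((latticeMembersVal D ≫ k).app d i) (X.carrier.map (homOfLE h) z)) ↔
        X.leAt c (k.app c x) z ∧ X.leAt c (k.app c y) z := by
    intro c x y z
    refine ⟨fun h' => ?_, ?_⟩
    · have h1 : ∀ b : Bool, X.leAt c (k.app c (cond b x y)) z := fun b => by
        have h2 := h' c le_rfl ((x, y), b) (Functor.map_id_apply (latticePairs D) c _).symm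
        rwa [show X.carrier.map (homOfLE (le_refl c)) z = z from
          Functor.map_id_apply X.carrier c z] at h2
      exact ⟨h1 true, h1 false⟩
    · rintro ⟨h1, h2⟩ d hd ⟨⟨x', y'⟩, b⟩ hi
      obtain ⟨rfl, rfl⟩ := Prod.mk.inj hi
      have h1' := InternalPoset.leAt_map hd h1
      have h2' := InternalPoset.leAt_map hd h2
      rw [← IsLatticeHom.app_map] at h1' h2'
      cases b
      · exact h2'
      · exact h1'
  rw [InternalPoset.isTop_iff_leAt, InternalPoset.isMeet_iff_leAt, InternalPoset.isJoin_iff_leAt,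
    InternalPoset.isJoin_iff_leAt]
  constructor
  · exact fun hk => ⟨fun c p z => hk.le_top c z, fun c p z => hk.le_inf_iff c p.1 p.2 z,
      fun c p z => iff_of_true (hk.bot_le c z) fun d h i => i.elim,
      fun c p z => (hk.sup_le_iff c p.1 p.2 z).trans (key c p.1 p.2 z).symm⟩
  · rintro ⟨h1, h2, h3, h4⟩
    exact ⟨fun c z => h1 c ((⊤ : D.obj c), (⊤ : D.obj c)) z, fun c z =>
      (h3 c ((⊤ : D.obj c), (⊤ : D.obj c)) z).2 fun d h i => i.elim,
      fun c x y z => h2 c (x, y) z, fun c x y z => (h4 c (x, y) z).trans (key c x y z)⟩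

lemma principalHom_isLatticeHom : IsLatticeHom (idlPoset D) (principalHom D) where
  le_top c J := (idl_leAt _ _).2 fun d hd x hx => (mem_principal_ideal (⊤ : D.obj c) hd x).2
    (le_top.trans_eq (map_top (D.map (homOfLE hd)).hom).symm)
  bot_le c J := (idl_leAt _ _).2 ((principal_le_iff _ _).2 (J.ideal c le_rfl).bot_mem)
  le_inf_iff c x y J := by
    refine (idl_leAt _ _).trans (Iff.trans ?_ (and_congr (idl_leAt _ _).symm (idl_leAt _ _).symm))
    have key : ∀ d (hd : c ≤ d) (w : D.obj d),
        w ∈ (IdealSection.principal D c (x ⊓ y)).ideal d hd ↔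
          w ∈ (IdealSection.principal D c x).ideal d hd ∧
            w ∈ (IdealSection.principal D c y).ideal d hd := by
      intro d hd w
      rw [mem_principal_ideal, mem_principal_ideal, mem_principal_ideal, ← le_inf_iff]
      exact iff_of_eq (congrArg (w ≤ ·) (map_inf (D.map (homOfLE hd)).hom x y))
    exact ⟨fun h => ⟨fun d hd w hw => ((key d hd w).1 (h d hd hw)).1,
      fun d hd w hw => ((key d hd w).1 (h d hd hw)).2⟩,
      fun h d hd w hw => (key d hd w).2 ⟨h.1 d hd hw, h.2 d hd hw⟩⟩
  sup_le_iff c x y J := (idl_leAt _ _).trans ((principal_le_iff _ J).trans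
    (Order.Ideal.sup_mem_iff.trans (and_congr ((principal_le_iff x J).symm.trans
      (idl_leAt _ _).symm) ((principal_le_iff y J).symm.trans (idl_leAt _ _).symm))))

end Pairs

/-! ### Inverse images of ideal completions -/

lemma GeometricMorphism.tr_injective {E : Type u₁} [Category.{v₁} E] {E' : Type u₂}
    [Category.{v₂} E'] (f : GeometricMorphism E E') {T : E'} {X : E} :
    Function.Injective (f.tr : (T ⟶ f.direct.obj X) → _) :=
  (f.adj.homEquiv T X).symm.injective

section Sharp

variable {C C' : Type u} [PartialOrder C] [PartialOrder C'] (φ : C →o C')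
  (D : C' ⥤ BddDistLat.{u})

/-- The restriction of a functor of ideals along an isotone map `φ`: an ideal section `J` of `D` at
`φ c` is sent to the ideal section `d ↦ J (φ d)` of `φ^* D` at `c`. -/
def idlRestrict : (kripkeMap φ).inverse.obj (idlFunctor D) ⟶
    idlFunctor (φ.monotone.functor ⋙ D) where
  app c := ↾(fun J : IdealSection D (φ c) =>
    { ideal := fun d h => J.ideal (φ d) (φ.monotone h)
      map_mem := fun d d' h h' x hx =>
        J.map_mem (φ d) (φ d') (φ.monotone h) (φ.monotone h') x hx })
  naturality _ _ _ := rfl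

/-- The unit `Idl D ⟶ φ_* Idl (φ^* D)`.  It preserves joins because the internal join of ideals is
computed separately at each stage. -/
noncomputable def idlUnit : idl D ⟶
    (InternalFrame.pushforward (kripkeMap φ)).obj (idl (φ.monotone.functor ⋙ D)) where
  hom := (kripkeMap φ).untr (idlRestrict φ D)
  map_top T t ht := by
    refine InternalFrame.push_isTop_of _ _ ?_
    rw [GeometricMorphism.tr_precomp, GeometricMorphism.tr_untr]
    have h : (idlPoset D).IsTop (idlTop D T) :=
      fun T' α z => (idl_le D _ _).2 fun c t d hd => le_top
    obtain rfl := ht.unique h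
    exact fun T' α z => (idl_le _ _ _).2 fun c t d hd => le_top
  map_meet T x y m hm := by
    refine InternalFrame.push_isMeet_of _ _ ?_
    rw [GeometricMorphism.tr_precomp, GeometricMorphism.tr_precomp, GeometricMorphism.tr_precomp,
      GeometricMorphism.tr_untr]
    obtain rfl := hm.unique (idlMeet_isMeet D x y)
    exact idlMeet_isMeet (φ.monotone.functor ⋙ D) _ _
  map_join I T e q s hs := by
    refine InternalFrame.push_isJoin_of _ _ ?_
    rw [GeometricMorphism.tr_precomp, GeometricMorphism.tr_precomp, GeometricMorphism.tr_untr]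
    obtain rfl := hs.unique (idlJoin_isJoin D e q)
    exact idlJoin_isJoin (φ.monotone.functor ⋙ D) _ _

variable {D}

section

variable {φ} {H : InternalFrame (C ⥤ Type u)}
  (k : idl D ⟶ (InternalFrame.pushforward (kripkeMap φ)).obj H)

/-- The morphism `φ^* D ⟶ H` obtained by transposing the restriction `D ⟶ φ_* H` of a homomorphism
of internal frames `Idl D ⟶ φ_* H`. -/
noncomputable def transposeElems : latticeElems (φ.monotone.functor ⋙ D) ⟶ H.carrier :=
  (kripkeMap φ).tr (principalHom D ≫ InternalFrame.Hom.hom k)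

lemma transposeElems_isLatticeHom : IsLatticeHom H.toInternalPoset (transposeElems k) := by
  have htr : ∀ {T : C' ⥤ Type u} (a : T ⟶ latticeElems D),
      (kripkeMap φ).tr ((a ≫ principalHom D) ≫ InternalFrame.Hom.hom k) =
        (kripkeMap φ).inverse.map a ≫ transposeElems k := fun a => by
    rw [Category.assoc, GeometricMorphism.tr_precomp]
    rfl
  obtain ⟨h1, h2, h3, h4⟩ := isLatticeHom_iff.1 (principalHom_isLatticeHom (D := D))
  replace h1 := (InternalFrame.push_isTop_iff _ _).1 (k.map_top _ h1)
  replace h2 := (InternalFrame.push_isMeet_iff _ _).1 (k.map_meet _ _ _ h2)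
  replace h3 := (InternalFrame.push_isJoin_iff _ _).1 (k.map_join _ _ _ h3)
  replace h4 := (InternalFrame.push_isJoin_iff _ _).1 (k.map_join _ _ _ h4)
  rw [htr] at h1 h3
  rw [htr, htr, htr] at h2
  rw [htr, htr] at h4
  have h0 : (kripkeMap φ).tr (emptyHom (idlFunctor D) ≫ InternalFrame.Hom.hom k) =
      emptyHom H.carrier :=
    NatTrans.ext (funext fun c => by ext x; exact PEmpty.elim x)
  -- `erw`, since the inverse image of the empty functor is the empty functor only by unfolding
  erw [h0] at h3
  exact isLatticeHom_iff.2 ⟨h1, h2, h3, h4⟩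

end

lemma tr_idlUnit_comp {H : InternalFrame (C ⥤ Type u)}
    (l : idl (φ.monotone.functor ⋙ D) ⟶ H) :
    (kripkeMap φ).tr (InternalFrame.Hom.hom
      (idlUnit φ D ≫ (InternalFrame.pushforward (kripkeMap φ)).map l)) =
        idlRestrict φ D ≫ InternalFrame.Hom.hom l := by
  rw [InternalFrame.comp_hom]
  refine (GeometricMorphism.tr_postcomp _ _ _).trans ?_
  change (kripkeMap φ).tr ((kripkeMap φ).untr (idlRestrict φ D)) ≫ _ = _
  rw [GeometricMorphism.tr_untr]

lemma transposeElems_idlUnit_comp {H : InternalFrame (C ⥤ Type u)}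
    (l : idl (φ.monotone.functor ⋙ D) ⟶ H) :
    transposeElems (idlUnit φ D ≫ (InternalFrame.pushforward (kripkeMap φ)).map l) =
      principalHom (φ.monotone.functor ⋙ D) ≫ InternalFrame.Hom.hom l := by
  unfold transposeElems
  rw [GeometricMorphism.tr_precomp, tr_idlUnit_comp]
  rfl

/-- Homomorphisms `Idl D ⟶ φ_* H` are determined by the transposes of their restrictions to `D`. -/
lemma transposeElems_injective {H : InternalFrame (C ⥤ Type u)} :
    Function.Injective (transposeElems :
      (idl D ⟶ (InternalFrame.pushforward (kripkeMap φ)).obj H) → _) := fun _ _ h =>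
  idl_hom_ext ((kripkeMap φ).tr_injective h)

/-- The ideal completion of the inverse image of an internal lattice `D` is the value at `Idl D` of
the left adjoint `φ^♯` of the direct image functor: homomorphisms `Idl D ⟶ φ_* H` and
`Idl (φ^* D) ⟶ H` both correspond to lattice homomorphisms `φ^* D ⟶ H`. -/
lemma idlUnit_isSharp (D : C' ⥤ BddDistLat.{u}) :
    InternalFrame.IsSharp (kripkeMap φ) (idl D) (idl (φ.monotone.functor ⋙ D))
      (idlUnit φ D) := by
  intro H k
  refine ⟨idlLift (transposeElems_isLatticeHom k), transposeElems_injective φ ?_, fun l hl => ?_⟩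
  · rw [transposeElems_idlUnit_comp, principalHom_idlLift]
  · refine idl_hom_ext ?_
    rw [principalHom_idlLift, ← hl, transposeElems_idlUnit_comp]

end Sharp

/-! ### Functoriality of the ideal completion -/

section IdealMap

variable {C : Type u} [PartialOrder C] {D₁ D₂ : C ⥤ BddDistLat.{u}} (a : D₁ ⟶ D₂)

/-- The morphism of underlying objects of a homomorphism of internal lattices. -/
def latticeElemsMap : latticeElems D₁ ⟶ latticeElems D₂ where
  app c := ↾(fun x => a.app c x)
  naturality c d f := by
    ext x
    exact NatTrans.naturality_apply a f x

lemma latticeElemsMap_isLatticeHom :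
    IsLatticeHom (idlPoset D₂) (latticeElemsMap a ≫ principalHom D₂) where
  le_top c J := by
    have := principalHom_isLatticeHom.le_top c J
    rwa [← map_top (a.app c).hom] at this
  bot_le c J := by
    have := principalHom_isLatticeHom.bot_le c J
    rwa [← map_bot (a.app c).hom] at this
  le_inf_iff c x y J := by
    have := principalHom_isLatticeHom.le_inf_iff c (a.app c x) (a.app c y) J
    rwa [← map_inf (a.app c).hom] at this
  sup_le_iff c x y J := by
    have := principalHom_isLatticeHom.sup_le_iff c (a.app c x) (a.app c y) J
    rwa [← map_sup (a.app c).hom] at this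

/-- The homomorphism `Idl D₁ ⟶ Idl D₂` extending a homomorphism of internal lattices. -/
noncomputable def idlMap : idl D₁ ⟶ idl D₂ :=
  idlLift (H := idl D₂) (latticeElemsMap_isLatticeHom a)

/-- `idlMap a` sends an ideal to the ideal generated by its image. -/
lemma mem_idlMap {c : C} (J : IdealSection D₁ c) {d : C} (hd : c ≤ d) (y : D₂.obj d) :
    y ∈ (show IdealSection D₂ c from (InternalFrame.Hom.hom (idlMap a)).app c J).ideal d hd ↔
      ∃ x ∈ J.ideal d hd, y ≤ a.app d x := by
  have hk := latticeElemsMap_isLatticeHom a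
  -- the ideal section generated by the image of `J`, shown to coincide with the join defining `idlMap`
  let K : IdealSection D₂ c :=
    { ideal := fun d hd => Order.IsIdeal.toIdeal
        (I := { y : D₂.obj d | ∃ x ∈ J.ideal d hd, y ≤ a.app d x })
        { IsLowerSet := fun y z hzy ⟨x, hx, hy⟩ => ⟨x, hx, hzy.trans hy⟩
          Nonempty := ⟨⊥, ⊥, (J.ideal d hd).bot_mem, bot_le⟩
          Directed := fun y ⟨x, hx, hy⟩ y' ⟨x', hx', hy'⟩ =>
            ⟨y ⊔ y', ⟨x ⊔ x', Order.Ideal.sup_mem hx hx',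
              (sup_le_sup hy hy').trans_eq (map_sup (a.app d).hom x x').symm⟩,
              le_sup_left, le_sup_right⟩ }
      map_mem := fun d d' h h' y ⟨x, hx, hy⟩ => ⟨D₁.map (homOfLE h') x,
        J.map_mem d d' h h' x hx, (OrderHomClass.mono (D₂.map (homOfLE h')).hom hy).trans_eq
          (NatTrans.naturality_apply a (homOfLE h') x).symm⟩ }
  constructor
  · intro hy
    refine (idl_leAt (D := D₂) _ K).1 ((idlLiftHom_le_iff (H := idl D₂) hk J K).2 ?_) d hd hy
    intro d hd x hx
    refine (idl_leAt _ _).2 ((principal_le_iff (a.app d x) _).2 ?_)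
    exact ⟨x, hx, le_rfl⟩
  · rintro ⟨x, hx, hy⟩
    have h1 := le_idlLiftHom (H := idl D₂) (k := latticeElemsMap a ≫ principalHom D₂)
      (J.restrict hd) hx
    rw [idlLiftHom_map] at h1
    have h2 := (principal_le_iff (a.app d x) _).1 ((idl_leAt _ _).1 h1)
    exact Order.Ideal.lower _ hy h2

end IdealMap

section Transpose

variable {C C' : Type u} [PartialOrder C] [PartialOrder C'] {φ : C →o C'}
  {D : C ⥤ BddDistLat.{u}} {D' : C' ⥤ BddDistLat.{u}} (a : φ.monotone.functor ⋙ D' ⟶ D)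

/-- The homomorphism `Idl D' ⟶ φ_* Idl D` induced by a homomorphism of internal lattices
`φ^* D' ⟶ D`. -/
noncomputable def idlPush : idl D' ⟶ (InternalFrame.pushforward (kripkeMap φ)).obj (idl D) :=
  idlUnit φ D' ≫ (InternalFrame.pushforward (kripkeMap φ)).map (idlMap a)

/-- The value at a stage of the transpose of `idlPush a`. -/
noncomputable def idlPushAt {c : C} (J : IdealSection D' (φ c)) : IdealSection D c :=
  ((kripkeMap φ).tr (InternalFrame.Hom.hom (idlPush a))).app c J

lemma mem_idlPushAt {c : C} (J : IdealSection D' (φ c)) {d : C} (hd : c ≤ d) (y : D.obj d) :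
    y ∈ (idlPushAt a J).ideal d hd ↔
      ∃ x ∈ J.ideal (φ d) (φ.monotone hd), y ≤ a.app d x := by
  unfold idlPushAt idlPush
  rw [tr_idlUnit_comp]
  exact mem_idlMap a ((idlRestrict φ D').app c J) hd y

lemma idlPushAt_principal {c : C} (x : D'.obj (φ c)) :
    idlPushAt a (IdealSection.principal D' (φ c) x) = IdealSection.principal D c (a.app c x) := by
  refine IdealSection.ext (funext fun d => funext fun hd => SetLike.ext fun y => ?_)
  rw [mem_idlPushAt, mem_principal_ideal]
  have h : a.app d (D'.map (homOfLE (φ.monotone hd)) x) = D.map (homOfLE hd) (a.app c x) :=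
    NatTrans.naturality_apply a (homOfLE hd) x
  constructor
  · rintro ⟨w, hw, hy⟩
    rw [← h]
    exact hy.trans (OrderHomClass.mono (a.app d).hom ((mem_principal_ideal _ _ _).1 hw))
  · intro hy
    exact ⟨_, (mem_principal_ideal _ _ _).2 le_rfl, hy.trans_eq h.symm⟩

end Transpose

/-! ### Morphisms of framed topoi -/

/-- Framed geometric morphisms represent the same morphism if their inverse images are isomorphic,
compatibly with the transposes of the frame homomorphisms. -/
lemma FramedTopos.homMk_eq_of_inverse_iso {A B : FramedTopos.{v, u}} (f g : PreHom A B)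
    (ψ : g.geom.inverse ≅ f.geom.inverse)
    (h : ψ.hom.app B.frame.carrier ≫ f.geom.tr (InternalFrame.Hom.hom f.sharp) =
      g.geom.tr (InternalFrame.Hom.hom g.sharp)) : homMk f = homMk g := by
  refine Quotient.sound ⟨conjugateIsoEquiv f.geom.adj g.geom.adj ψ, g.geom.tr_injective ?_⟩
  rw [← h]
  simp only [GeometricMorphism.tr, Adjunction.homEquiv_counit, Functor.map_comp, Category.assoc]
  erw [conjugateEquiv_counit]
  exact ψ.hom.naturality_assoc _ _

lemma GeometricMorphism.tr_comp {E : Type u₁} [Category.{v₁} E] {E' : Type u₂} [Category.{v₂} E']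
    {E'' : Type u₃} [Category.{v₃} E''] (f : GeometricMorphism E E')
    (g : GeometricMorphism E' E'') {T : E''} {X : E} (z : T ⟶ g.direct.obj (f.direct.obj X)) :
    (f.comp g).tr (X := X) z = f.tr (g.tr z) := by
  simp only [GeometricMorphism.tr, GeometricMorphism.comp, Adjunction.comp_homEquiv]
  rfl

lemma FramedTopos.PreHom.tr_comp_sharp {A B B' : FramedTopos.{v, u}} (f : PreHom A B)
    (g : PreHom B B') : (f.comp g).geom.tr (InternalFrame.Hom.hom (f.comp g).sharp) =
      f.geom.inverse.map (g.geom.tr (InternalFrame.Hom.hom g.sharp)) ≫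
        f.geom.tr (InternalFrame.Hom.hom f.sharp) := by
  rw [PreHom.comp_sharp_hom]
  refine (GeometricMorphism.tr_comp f.geom g.geom _).trans ?_
  rw [GeometricMorphism.tr_postcomp]
  exact GeometricMorphism.tr_precomp _ _ _

lemma GeometricMorphism.tr_id {E : Type u₁} [Category.{v₁} E] {T X : E} (z : T ⟶ X) :
    (GeometricMorphism.id E).tr (X := X) z = z := by
  refine (Equiv.symm_apply_eq _).2 ?_
  rw [Adjunction.homEquiv_unit]
  exact (Category.id_comp z).symm

/-! ### Box presentations -/

namespace BoxPresentation

variable {P P' P'' : BoxPresentation.{u}}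

/-- The homomorphism of internal lattices `φ^* L' ⟶ L` induced by a morphism of box
presentations. -/
def logicNat (f : P' ⟶ P) :
    (contextMap f).monotone.functor ⋙ P'.latticeLogic ⟶ P.latticeLogic where
  app c := (forget₂ BoolAlg BddDistLat).map (logicHom f c)
  naturality _ _ _ := rfl

/-- The framed geometric morphism induced by a morphism of box presentations. -/
noncomputable def preHom (f : P' ⟶ P) : FramedTopos.PreHom P.framedTopos P'.framedTopos where
  geom := kripkeMap (contextMap f)
  sharp := idlPush (logicNat f)

/-- The inverse images agree by definition, since `c ↦ φ⁻¹(c)` is the identity for `φ = id`. -/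
lemma homMk_preHom_id (P : BoxPresentation.{u}) :
    FramedTopos.homMk (preHom (𝟙 P)) = 𝟙 P.framedTopos := by
  refine FramedTopos.homMk_eq_of_inverse_iso (preHom (𝟙 P)) (FramedTopos.PreHom.id P.framedTopos)
    (Iso.refl (𝟭 (P.Context ⥤ Type u))) ?_
  refine Eq.trans ?_ (GeometricMorphism.tr_id (𝟙 (idlFunctor P.latticeLogic))).symm
  refine sec_ext fun c J => IdealSection.ext (funext fun d => funext fun hd =>
    SetLike.ext fun y => ?_)
  refine (mem_idlPushAt (logicNat (𝟙 P)) J hd y).trans ⟨?_, fun hy => ⟨y, hy, ?_⟩⟩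
  · rintro ⟨x, hx, hy⟩
    exact (IdealSection.ideal J d hd).lower hy hx
  · exact le_rfl

/-- The inverse images agree by definition, since taking the inverse image of a context is
functorial on the nose; the transposed frame homomorphisms are compared by `mem_idlPushAt`. -/
lemma homMk_preHom_comp (f : P'' ⟶ P') (g : P' ⟶ P) :
    FramedTopos.homMk (preHom (f ≫ g)) =
      FramedTopos.homMk (preHom g) ≫ FramedTopos.homMk (preHom f) := by
  refine FramedTopos.homMk_eq_of_inverse_iso (preHom (f ≫ g))
    (FramedTopos.PreHom.comp (preHom g) (preHom f))
    (Iso.refl ((preHom f).geom.inverse ⋙ (preHom g).geom.inverse)) ?_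
  refine Eq.trans ?_ (FramedTopos.PreHom.tr_comp_sharp (preHom g) (preHom f)).symm
  refine sec_ext fun c J => IdealSection.ext (funext fun d => funext fun hd =>
    SetLike.ext fun z => ?_)
  refine (mem_idlPushAt (logicNat (f ≫ g)) J hd z).trans (Iff.trans ?_
    (mem_idlPushAt (logicNat g) (idlPushAt (logicNat f) J) hd z).symm)
  constructor
  · rintro ⟨x, hx, hz⟩
    exact ⟨(logicNat f).app _ x, (mem_idlPushAt (logicNat f) J _ _).2 ⟨x, hx, le_rfl⟩, hz⟩
  · rintro ⟨y, hy, hz⟩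
    obtain ⟨x, hx, hy⟩ := (mem_idlPushAt (logicNat f) J _ _).1 hy
    exact ⟨x, hx, hz.trans (OrderHomClass.mono ((logicNat g).app d).hom hy)⟩

/-- The functor `S/I ↦ (Set^C, Idl L)` from box presentations to framed topoi. -/
noncomputable def framedToposFunctor : BoxPresentation.{u}ᵒᵖ ⥤ FramedTopos.{u, u + 1} where
  obj P := P.unop.framedTopos
  map f := FramedTopos.homMk (preHom f.unop)
  map_id P := homMk_preHom_id P.unop
  map_comp f g := homMk_preHom_comp g.unop f.unop

end BoxPresentation

theorem mainTheorem2 :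
    ∃ (Φ : BoxPresentation.{u}ᵒᵖ ⥤ FramedTopos.{u, u + 1})
      (hΦ : ∀ P : BoxPresentation.{u}, Φ.obj (op P) = P.framedTopos),
      ∀ {P' P : BoxPresentation.{u}} (f : P' ⟶ P),
        ∃ h : P'.frame ⟶
            (InternalFrame.pushforward (kripkeMap (BoxPresentation.contextMap f))).obj P.frame,
          -- the value of the functor at `f` is the class of the geometric morphism induced by the
          -- isotone map of contexts, together with `h`
          Φ.map f.op = eqToHom (hΦ P) ≫
            FramedTopos.homMk (A := P.framedTopos) (B := P'.framedTopos)
              ⟨kripkeMap (BoxPresentation.contextMap f), h⟩ ≫ eqToHom (hΦ P').symm ∧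
          -- `h` extends the homomorphism of Boolean algebras `φ^* L' ⟶ L`
          (∀ (c : P.Context) (x : P'.latticeLogic.obj (BoxPresentation.contextMap f c)),
            ((kripkeMap (BoxPresentation.contextMap f)).tr (InternalFrame.Hom.hom h)).app c
                (IdealSection.principal P'.latticeLogic (BoxPresentation.contextMap f c) x) =
              IdealSection.principal P.latticeLogic c (BoxPresentation.logicHom f c x)) ∧
          -- `h` is the transpose of an internal frame homomorphism `φ^♯ F' ⟶ F`
          ∃ (G : InternalFrame (P.Context ⥤ Type u))
            (η : P'.frame ⟶
              (InternalFrame.pushforward (kripkeMap (BoxPresentation.contextMap f))).obj G)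
            (sharp : G ⟶ P.frame),
            InternalFrame.IsSharp (kripkeMap (BoxPresentation.contextMap f)) P'.frame G η ∧
              η ≫ (InternalFrame.pushforward
                (kripkeMap (BoxPresentation.contextMap f))).map sharp = h := by
  refine ⟨BoxPresentation.framedToposFunctor, fun _ => rfl, fun {P' P} f =>
    ⟨idlPush (BoxPresentation.logicNat f), ?_, fun c x => ?_, idl _,
      idlUnit (BoxPresentation.contextMap f) P'.latticeLogic,
      idlMap (BoxPresentation.logicNat f), idlUnit_isSharp _ _, rfl⟩⟩
  · exact ((Category.id_comp _).trans (Category.comp_id _)).symm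
  · exact idlPushAt_principal (BoxPresentation.logicNat f) x
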